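/- Let $m\ge 0$ be an integer (for $m=0$ the ball below is a single point) and let $\mathbb B^m$ be the open Euclidean unit ball of $\mathbb C^m$. For a complex Hilbert space $\mathcal E$ let $H^2_m\otimes\mathcal E$ be the $\mathcal E$-valued Drury--Arveson space, i.e. the Hilbert space of all functions $f(z)=\sum_{k\in\mathbb N^m}a_kz^k$ on $\mathbb B^m$ with $a_k\in\mathcal E$ and $$\|f\|^2=\sum_{k}\frac{\|a_k\|^2}{\gamma_k}<\infty,\qquad \gamma_k=\frac{(k_1+\cdots+k_m)!}{k_1!\cdots k_m!};$$ equivalently, the reproducing kernel Hilbert space with kernel $(1-\sum_i z_i\bar w_i)^{-1}I_{\mathcal E}$. It is a module over $\mathbb C[z_1,\dots,z_m]$ under pointwise multiplication. For complex Hilbert spaces $\mathcal E,\mathcal E_*$ let $\mathcal M(\mathcal E,\mathcal E_*)$ be the set of multipliers, i.e. of holomorphic functions $\theta:\mathbb B^m\to\mathcal L(\mathcal E,\mathcal E_*)$ such that $\theta f\in H^2_m\otimes\mathcal E_*$ for all $f\in H^2_m\otimes\mathcal E$; then $M_\theta f=\theta f$ is a bounded module map $H^2_m\otimes\mathcal E\to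 H^2_m\otimes\mathcal E_*$. A submodule is a closed subspace invariant under multiplication by polynomials; a submodule $\mathcal S$ of $H^2_m\otimes\mathcal E_*$ is complemented if $H^2_m\otimes\mathcal E_*$ is the (not necessarily orthogonal) algebraic direct sum of $\mathcal S$ and another submodule. Two modules are similar if there is a bounded module map between them with a bounded inverse. Let $\theta\in\mathcal M(\mathcal E,\mathcal E_*)$ and put $\mathcal H_\theta=(H^2_m\otimes\mathcal E_*)/\operatorname{clos}[\operatorname{ran}M_\theta]$, with the quotient norm and quotient module structure. Then the following statements are equivalent: (i) there exists $\psi\in\mathcal M(\mathcal E_*,\mathcal E)$ such that $\psi(z)\theta(z)=I_{\mathcal E}$ for all $z\in\mathbb B^m$; (ii) $\operatorname{ran}M_\theta$ is closed, $\ker M_\theta=\{0\}$, and $\mathcal H_\theta$ is similar to a complemented submodule $\mathcal S$ of $H^2_m\otimes\mathcal E_*$. -/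

import Mathlib

open scoped ComplexConjugate

noncomputable section

/-- The open unit ball of `ℂᵐ` (with the Euclidean norm). -/
abbrev UnitBall (m : ℕ) : Type :=
  Metric.ball (0 : EuclideanSpace ℂ (Fin m)) 1

/-- The multinomial coefficient `(k₁ + ⋯ + kₘ)! / (k₁! ⋯ kₘ!)`. -/
def multinom {m : ℕ} (k : Fin m → ℕ) : ℕ := Nat.multinomial Finset.univ k

/-- The monomial `z₁ ^ k₁ ⋯ zₘ ^ kₘ`. -/
def zpw {m : ℕ} (z : Fin m → ℂ) (k : Fin m → ℕ) : ℂ := ∏ i, z i ^ k i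

/-- The `E`-valued Drury-Arveson space `H²ₘ(E) = H²ₘ ⊗ E`. An element is the power series
`f(z) = ∑ₖ aₖ zᵏ` with `aₖ ∈ E` and `‖f‖² = ∑ₖ ‖aₖ‖² / γₖ < ∞`, where `γₖ` is the multinomial
coefficient; it is stored as the square summable family of its normalised coefficients
`aₖ / √γₖ` (see `DruryArveson.coeff`, `DruryArveson.norm_sq_eq`, `DruryArveson.hasSum_apply` and
`DruryArveson.exists_of_summable`; `DruryArveson.kernel_eq` identifies the kernel). -/
def DruryArveson (m : ℕ) (E : Type*) [NormedAddCommGroup E] : Type _ :=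
  lp (fun _ : Fin m → ℕ => E) 2

section multinomial

variable {m : ℕ}

theorem multinom_pos (k : Fin m → ℕ) : 0 < multinom k := Nat.multinomial_pos _ _

theorem multinom_le_add_single (k : Fin m → ℕ) (i : Fin m) :
    multinom k ≤ multinom (k + Pi.single i 1) := by
  have h1 := Nat.multinomial_spec Finset.univ k
  have h2 := Nat.multinomial_spec Finset.univ (k + Pi.single i 1)
  have hs : ∑ j, (k + Pi.single i 1 : Fin m → ℕ) j = ∑ j, k j + 1 := by
    simp [Finset.sum_add_distrib]
  have hp : ∏ j, ((k + Pi.single i 1 : Fin m → ℕ) j).factorial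
      = (k i + 1) * ∏ j, (k j).factorial := by
    rw [← Finset.mul_prod_erase _ _ (Finset.mem_univ i),
      ← Finset.mul_prod_erase _ (fun j => (k j).factorial) (Finset.mem_univ i)]
    rw [Finset.prod_congr rfl (g := fun j => (k j).factorial)]
    · simp [Nat.factorial_succ, mul_assoc]
    · intro j hj
      simp [Finset.ne_of_mem_erase hj]
  rw [hs, hp, Nat.factorial_succ, ← h1] at h2
  have hP : 0 < ∏ j, (k j).factorial := Finset.prod_pos fun j _ => Nat.factorial_pos _
  have hki : k i ≤ ∑ j, k j := Finset.single_le_sum (fun _ _ => Nat.zero_le _) (Finset.mem_univ i)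
  have h3 : (k i + 1) * multinom (k + Pi.single i 1) = (∑ j, k j + 1) * multinom k := by
    apply Nat.eq_of_mul_eq_mul_left hP
    unfold multinom
    linarith
  have h4 : (k i + 1) * multinom k ≤ (k i + 1) * multinom (k + Pi.single i 1) := by
    rw [h3]
    gcongr
  exact Nat.le_of_mul_le_mul_left h4 (Nat.succ_pos _)

/-- Summation over multi-indices by total degree. -/
theorem hasSum_by_degree {F : Type*} [NormedAddCommGroup F]
    {f : (Fin m → ℕ) → F} {s : F} (h : HasSum f s) :
    HasSum (fun n => ∑ k ∈ Finset.piAntidiag Finset.univ n, f k) s := by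
  have e := (Equiv.sigmaFiberEquiv (fun k : Fin m → ℕ => ∑ i, k i)).hasSum_iff.2 h
  refine HasSum.sigma e fun n => ?_
  have hf := Finset.hasSum (Finset.piAntidiag (Finset.univ : Finset (Fin m)) n) f
  let g : {k : Fin m → ℕ // ∑ i, k i = n} ≃
      {k // k ∈ Finset.piAntidiag (Finset.univ : Finset (Fin m)) n} :=
    Equiv.subtypeEquivRight fun k => by simp
  exact g.hasSum_iff.2 hf

theorem summable_by_degree {f : (Fin m → ℕ) → ℝ} (h0 : ∀ k, 0 ≤ f k)
    (h : Summable fun n => ∑ k ∈ Finset.piAntidiag Finset.univ n, f k) : Summable f := by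
  refine summable_of_sum_le (c := ∑' n, ∑ k ∈ Finset.piAntidiag Finset.univ n, f k) h0 fun u => ?_
  classical
  let d : (Fin m → ℕ) → ℕ := fun k => ∑ i, k i
  calc ∑ k ∈ u, f k = ∑ n ∈ u.image d, ∑ k ∈ u with d k = n, f k :=
        (Finset.sum_fiberwise_of_maps_to (fun k hk => Finset.mem_image_of_mem d hk) f).symm
    _ ≤ ∑ n ∈ u.image d, ∑ k ∈ Finset.piAntidiag Finset.univ n, f k := by
        refine Finset.sum_le_sum fun n _ => Finset.sum_le_sum_of_subset_of_nonneg ?_ ?_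
        · intro k hk
          simpa [d] using (Finset.mem_filter.1 hk).2
        · exact fun k _ _ => h0 k
    _ ≤ _ := h.sum_le_tsum _ fun n _ => Finset.sum_nonneg fun k _ => h0 k

theorem norm_zpw (x : Fin m → ℂ) (k : Fin m → ℕ) : ‖zpw x k‖ = ∏ i, ‖x i‖ ^ k i := by
  simp [zpw, norm_prod]

theorem summable_multinom {x : Fin m → ℂ} (hx : ∑ i, ‖x i‖ < 1) :
    Summable fun k : Fin m → ℕ => (multinom k : ℝ) * ‖zpw x k‖ := by
  refine summable_by_degree (fun k => by positivity) ?_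
  have : ∀ n, ∑ k ∈ Finset.piAntidiag (Finset.univ : Finset (Fin m)) n,
      (multinom k : ℝ) * ‖zpw x k‖ = (∑ i, ‖x i‖) ^ n := fun n => by
    rw [Finset.sum_pow_eq_sum_piAntidiag]
    simp [multinom, norm_zpw]
  simp_rw [this]
  exact summable_geometric_of_lt_one (Finset.sum_nonneg fun _ _ => norm_nonneg _) hx

theorem hasSum_multinom {x : Fin m → ℂ} (hx : ∑ i, ‖x i‖ < 1) :
    HasSum (fun k : Fin m → ℕ => (multinom k : ℂ) * zpw x k) (1 - ∑ i, x i)⁻¹ := by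
  have hs : Summable fun k : Fin m → ℕ => (multinom k : ℂ) * zpw x k :=
    .of_norm (by simpa using summable_multinom hx)
  have h1 := hasSum_by_degree hs.hasSum
  have : ∀ n, ∑ k ∈ Finset.piAntidiag (Finset.univ : Finset (Fin m)) n,
      (multinom k : ℂ) * zpw x k = (∑ i, x i) ^ n := fun n => by
    rw [Finset.sum_pow_eq_sum_piAntidiag]
    simp [multinom, zpw]
  simp_rw [this] at h1
  have h2 := hasSum_geometric_of_norm_lt_one ((norm_sum_le _ _).trans_lt hx)
  rw [← h1.unique h2]
  exact hs.hasSum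

theorem sum_norm_mul_conj_lt (z w : UnitBall m) :
    ∑ i, ‖z.1 i * conj (w.1 i)‖ < 1 := by
  have hz : ‖z.1‖ < 1 := mem_ball_zero_iff.1 z.2
  have hw : ‖w.1‖ < 1 := mem_ball_zero_iff.1 w.2
  calc ∑ i, ‖z.1 i * conj (w.1 i)‖ = ∑ i, ‖z.1 i‖ * ‖w.1 i‖ := by simp
    _ ≤ √(∑ i, ‖z.1 i‖ ^ 2) * √(∑ i, ‖w.1 i‖ ^ 2) := Real.sum_mul_le_sqrt_mul_sqrt _ _ _
    _ = ‖z.1‖ * ‖w.1‖ := by rw [EuclideanSpace.norm_eq, EuclideanSpace.norm_eq]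
    _ < 1 := mul_lt_one_of_nonneg_of_lt_one_left (norm_nonneg _) hz hw.le

theorem summable_sq_zpw (z : UnitBall m) :
    Summable fun k : Fin m → ℕ => (√(multinom k : ℝ) * ‖zpw z.1 k‖) ^ 2 := by
  refine (summable_multinom (sum_norm_mul_conj_lt z z)).congr fun k => ?_
  rw [mul_pow, Real.sq_sqrt (Nat.cast_nonneg _), norm_zpw, norm_zpw, ← Finset.prod_pow]
  congr 1
  refine Finset.prod_congr rfl fun i _ => ?_
  rw [norm_mul, RCLike.norm_conj, mul_pow, ← pow_mul, mul_comm (k i) 2, pow_mul, sq, mul_pow]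

end multinomial

namespace DruryArveson

variable {m : ℕ} {E : Type*} [NormedAddCommGroup E]

instance : NormedAddCommGroup (DruryArveson m E) :=
  inferInstanceAs (NormedAddCommGroup (lp (fun _ : Fin m → ℕ => E) 2))

/-- The identification with the square summable families of normalised coefficients. -/
def toLp (f : DruryArveson m E) : lp (fun _ : Fin m → ℕ => E) 2 := f

/-- The element with given normalised coefficients. -/
def ofLp (b : lp (fun _ : Fin m → ℕ => E) 2) : DruryArveson m E := b

variable [InnerProductSpace ℂ E]

instance : InnerProductSpace ℂ (DruryArveson m E) :=
  inferInstanceAs (InnerProductSpace ℂ (lp (fun _ : Fin m → ℕ => E) 2))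

instance [CompleteSpace E] : CompleteSpace (DruryArveson m E) :=
  inferInstanceAs (CompleteSpace (lp (fun _ : Fin m → ℕ => E) 2))

/-- The power series coefficient `aₖ` of `f(z) = ∑ₖ aₖ zᵏ`. -/
def coeff (f : DruryArveson m E) (k : Fin m → ℕ) : E := (√(multinom k : ℝ) : ℂ) • f.toLp k

/-- The value `f(z) = ∑ₖ aₖ zᵏ`. -/
def eval (z : UnitBall m) (f : DruryArveson m E) : E := ∑' k, zpw z.1 k • f.coeff k

theorem norm_coeff_sq (f : DruryArveson m E) (k : Fin m → ℕ) :
    ‖f.coeff k‖ ^ 2 = multinom k * ‖f.toLp k‖ ^ 2 := by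
  rw [coeff, norm_smul, mul_pow, Complex.norm_real, Real.norm_of_nonneg (Real.sqrt_nonneg _),
    Real.sq_sqrt (Nat.cast_nonneg _)]

theorem hasSum_norm_sq (f : DruryArveson m E) :
    HasSum (fun k => ‖f.coeff k‖ ^ 2 / multinom k) (‖f‖ ^ 2) := by
  have h := lp.hasSum_norm (p := 2) (by norm_num) f.toLp
  simp only [ENNReal.toReal_ofNat, Real.rpow_ofNat] at h
  refine h.congr_fun ?_
  intro k
  have : (multinom k : ℝ) ≠ 0 := Nat.cast_ne_zero.2 (multinom_pos k).ne'
  rw [norm_coeff_sq]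
  field_simp

theorem norm_sq_eq (f : DruryArveson m E) : ‖f‖ ^ 2 = ∑' k, ‖f.coeff k‖ ^ 2 / multinom k :=
  f.hasSum_norm_sq.tsum_eq.symm

/-- Every family of coefficients with `∑ₖ ‖aₖ‖² / γₖ < ∞` occurs. -/
theorem exists_of_summable (a : (Fin m → ℕ) → E)
    (ha : Summable fun k => ‖a k‖ ^ 2 / multinom k) :
    ∃ f : DruryArveson m E, ∀ k, f.coeff k = a k := by
  refine ⟨ofLp ⟨fun k => ((√(multinom k : ℝ) : ℂ))⁻¹ • a k, ?_⟩, fun k => ?_⟩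
  · refine memℓp_gen (ha.congr fun k => ?_)
    rw [norm_smul, norm_inv, Complex.norm_real, Real.norm_of_nonneg (Real.sqrt_nonneg _)]
    simp only [ENNReal.toReal_ofNat, Real.rpow_ofNat]
    rw [mul_pow, inv_pow, Real.sq_sqrt (Nat.cast_nonneg _), div_eq_inv_mul]
  · have : ((√(multinom k : ℝ) : ℂ)) ≠ 0 := by
      have := multinom_pos k
      exact_mod_cast (Real.sqrt_pos.2 (by exact_mod_cast this)).ne'
    exact smul_inv_smul₀ this _

theorem norm_term (z : UnitBall m) (f : DruryArveson m E) (k : Fin m → ℕ) :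
    ‖zpw z.1 k • f.coeff k‖ = (√(multinom k : ℝ) * ‖zpw z.1 k‖) * ‖f.toLp k‖ := by
  rw [coeff, norm_smul, norm_smul, Complex.norm_real, Real.norm_of_nonneg (Real.sqrt_nonneg _)]
  ring

theorem summable_norm_term (z : UnitBall m) (f : DruryArveson m E) :
    Summable (fun k => ‖zpw z.1 k • f.coeff k‖) ∧
      ∑' k, ‖zpw z.1 k • f.coeff k‖ ≤
        √(∑' k : Fin m → ℕ, (√(multinom k : ℝ) * ‖zpw z.1 k‖) ^ 2) * ‖f‖ := by
  have h := lp.hasSum_norm (p := 2) (by norm_num) f.toLp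
  have hc : (2 : ℝ).HolderConjugate 2 := by rw [Real.holderConjugate_iff]; norm_num
  have h2 := summable_sq_zpw z
  have := Real.summable_and_inner_le_Lp_mul_Lq_tsum_of_nonneg hc
    (f := fun k : Fin m → ℕ => √(multinom k : ℝ) * ‖zpw z.1 k‖) (g := fun k => ‖f.toLp k‖)
    (fun k => by positivity) (fun k => by positivity) (by simpa using h2)
    (by simpa using h.summable)
  simp_rw [norm_term]
  refine ⟨this.1, this.2.trans_eq ?_⟩
  simp only [ENNReal.toReal_ofNat, Real.rpow_ofNat] at h
  simp only [Real.rpow_ofNat]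
  rw [h.tsum_eq, ← Real.sqrt_eq_rpow, ← Real.sqrt_eq_rpow, Real.sqrt_sq (norm_nonneg _)]
  rfl

theorem coeff_add (f g : DruryArveson m E) (k : Fin m → ℕ) :
    (f + g).coeff k = f.coeff k + g.coeff k := smul_add _ _ _

theorem coeff_smul (c : ℂ) (f : DruryArveson m E) (k : Fin m → ℕ) :
    (c • f).coeff k = c • f.coeff k := smul_comm _ _ _

variable [CompleteSpace E]

theorem hasSum_apply' (z : UnitBall m) (f : DruryArveson m E) :
    HasSum (fun k => zpw z.1 k • f.coeff k) (eval z f) :=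
  (summable_norm_term z f).1.of_norm.hasSum

/-- Evaluation at a point of the ball as a bounded operator. -/
def evalCLM (z : UnitBall m) : DruryArveson m E →L[ℂ] E :=
  LinearMap.mkContinuous
    { toFun := eval z
      map_add' := fun f g => by
        refine (hasSum_apply' z (f + g)).unique ?_
        simpa [coeff_add] using (hasSum_apply' z f).add (hasSum_apply' z g)
      map_smul' := fun c f => by
        refine (hasSum_apply' z (c • f)).unique ?_
        simpa [coeff_smul, smul_comm c] using (hasSum_apply' z f).const_smul c }
    (√(∑' k : Fin m → ℕ, (√(multinom k : ℝ) * ‖zpw z.1 k‖) ^ 2))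
    fun f => (norm_tsum_le_tsum_norm (summable_norm_term z f).1).trans (summable_norm_term z f).2

theorem coeff_eq_zero_of_eval_eq_zero (f : DruryArveson m E) (h : ∀ z, eval z f = 0)
    (k₀ : Fin m → ℕ) : f.coeff k₀ = 0 := by
  classical
  -- the homogeneous parts vanish on the ball
  have hom : ∀ (z : UnitBall m) (n : ℕ),
      ∑ k ∈ Finset.piAntidiag Finset.univ n, zpw z.1 k • f.coeff k = 0 := by
    intro z
    have hz : ‖z.1‖ < 1 := mem_ball_zero_iff.1 z.2
    let P : ℕ → E := fun n => ∑ k ∈ Finset.piAntidiag Finset.univ n, zpw z.1 k • f.coeff k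
    have hP : ∀ t : ℂ, ‖t‖ < 1 → HasSum (fun n => t ^ n • P n) 0 := by
      intro t ht
      let w : UnitBall m := ⟨t • z.1, by
        simpa [norm_smul] using mul_lt_one_of_nonneg_of_lt_one_left (norm_nonneg _) ht hz.le⟩
      have := hasSum_by_degree (hasSum_apply' w f)
      rw [h w] at this
      refine this.congr_fun fun n => ?_
      simp only [P, Finset.smul_sum]
      refine Finset.sum_congr rfl fun k hk => ?_
      have hk' : ∑ i, k i = n := by simpa using hk
      rw [← mul_smul]
      congr 1
      simp [zpw, w, mul_pow, Finset.prod_mul_distrib, Finset.prod_pow_eq_pow_sum, hk']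
    let p : FormalMultilinearSeries ℂ ℂ E := fun n => ContinuousMultilinearMap.mkPiRing ℂ (Fin n) (P n)
    have hp : HasFPowerSeriesAt (0 : ℂ → E) p 0 := by
      rw [hasFPowerSeriesAt_iff]
      filter_upwards [Metric.ball_mem_nhds (0 : ℂ) one_pos] with t ht
      simpa [p, FormalMultilinearSeries.coeff] using hP t (by simpa using ht)
    intro n
    have := congrFun hp.eq_zero n
    have h1 : p n (fun _ => 1) = 0 := by rw [this]; rfl
    simpa [p] using h1
  refine ext_inner_left ℂ fun v => ?_
  rw [inner_zero_right]
  let n := ∑ i, k₀ i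
  let Q : MvPolynomial (Fin m) ℂ := ∑ k ∈ Finset.piAntidiag Finset.univ n,
    MvPolynomial.monomial (Finsupp.equivFunOnFinite.symm k) (inner ℂ v (f.coeff k))
  have hQ : Q = 0 := by
    refine MvPolynomial.funext_set (fun _ => Metric.ball (0 : ℂ) (1 / (m + 1))) (fun _ => ?_) ?_
    · exact infinite_of_mem_nhds 0 (Metric.ball_mem_nhds _ (by positivity))
    · intro x hx
      have hx' : ∀ i, ‖x i‖ < 1 / (m + 1) := fun i => by simpa using hx i (Set.mem_univ i)
      have hb : ‖(WithLp.toLp 2 x : EuclideanSpace ℂ (Fin m))‖ < 1 := by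
        rw [EuclideanSpace.norm_eq, Real.sqrt_lt' one_pos]
        calc ∑ i, ‖x i‖ ^ 2 ≤ ∑ i : Fin m, (1 / ((m : ℝ) + 1)) ^ 2 := by
              gcongr with i
              exact (hx' i).le
          _ = m / ((m : ℝ) + 1) ^ 2 := by simp [div_eq_mul_inv]
          _ < 1 ^ 2 := by
              rw [div_lt_iff₀ (by positivity)]
              nlinarith [(Nat.cast_nonneg m : (0 : ℝ) ≤ m)]
      have := congrArg (inner ℂ v) (hom ⟨WithLp.toLp 2 x, by simpa using hb⟩ n)
      rw [inner_zero_right, inner_sum] at this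
      rw [map_zero, ← this, map_sum]
      refine Finset.sum_congr rfl fun k _ => ?_
      rw [MvPolynomial.eval_monomial, inner_smul_right, mul_comm]
      congr 1
      simp [zpw, Finsupp.prod_fintype]
  have := congrArg (MvPolynomial.coeff (Finsupp.equivFunOnFinite.symm k₀)) hQ
  rw [MvPolynomial.coeff_sum, MvPolynomial.coeff_zero] at this
  rw [← this, Finset.sum_eq_single k₀]
  · simp
  · intro k _ hk
    rw [MvPolynomial.coeff_monomial, if_neg]
    simpa using hk
  · intro hk
    simp [n] at hk

/-- `H²ₘ(E)` is a reproducing kernel Hilbert space of `E`-valued functions on the unit ball. -/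
instance : RKHS ℂ (DruryArveson m E) (UnitBall m) E where
  coeCLM := ContinuousLinearMap.pi evalCLM
  coeCLM_injective := by
    refine (injective_iff_map_eq_zero _).2 fun f hf => ?_
    have h := coeff_eq_zero_of_eval_eq_zero f fun z => congrFun hf z
    have := f.hasSum_norm_sq
    simp only [h, norm_zero, ne_eq, OfNat.ofNat_ne_zero, not_false_eq_true, zero_pow,
      zero_div] at this
    simpa using this.unique hasSum_zero

/-- The elements of `H²ₘ(E)` are the functions `f(z) = ∑ₖ aₖ zᵏ`. -/
theorem hasSum_apply (f : DruryArveson m E) (z : UnitBall m) :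
    HasSum (fun k => zpw z.1 k • f.coeff k) (f z) := hasSum_apply' z f

/-- The reproducing kernel is `(z, w) ↦ (1 - ∑ᵢ zᵢ w̄ᵢ)⁻¹ I_E`. -/
theorem kernel_eq (z w : UnitBall m) :
    RKHS.kernel (DruryArveson m E) z w =
      (1 - ∑ i, z.1 i * conj (w.1 i))⁻¹ • ContinuousLinearMap.id ℂ E := by
  ext e
  have hs := hasSum_multinom (sum_norm_mul_conj_lt z w)
  have hz : ∀ k : Fin m → ℕ, zpw (fun i => z.1 i * conj (w.1 i)) k
      = zpw z.1 k * conj (zpw w.1 k) := fun k => by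
    simp [zpw, mul_pow, Finset.prod_mul_distrib]
  obtain ⟨g, hg⟩ := exists_of_summable (m := m)
    (fun k => ((multinom k : ℂ) * conj (zpw w.1 k)) • e) (by
      refine ((summable_sq_zpw w).mul_right (‖e‖ ^ 2)).congr fun k => ?_
      have : (multinom k : ℝ) ≠ 0 := Nat.cast_ne_zero.2 (multinom_pos k).ne'
      rw [norm_smul, norm_mul, RCLike.norm_conj, Complex.norm_natCast, mul_pow (√_),
        Real.sq_sqrt (Nat.cast_nonneg _)]
      field_simp)
  have hgw : RKHS.kerFun (DruryArveson m E) w e = g := by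
    refine ext_inner_right ℂ fun f => ?_
    rw [RKHS.kerFun_inner]
    have h1 := (hasSum_apply f w).mapL (innerSL ℂ e)
    have h2 := lp.hasSum_inner (𝕜 := ℂ) g.toLp f.toLp
    refine h1.unique (h2.congr_fun fun k => ?_)
    have hk : (√(multinom k : ℝ) : ℂ) ≠ 0 := by
      exact_mod_cast (Real.sqrt_pos.2 (by exact_mod_cast multinom_pos k)).ne'
    have h3 : g.toLp k = ((√(multinom k : ℝ) : ℂ) * conj (zpw w.1 k)) • e := by
      have h4 := hg k
      rw [coeff] at h4
      apply smul_right_injective E hk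
      dsimp only
      rw [h4, smul_smul, ← mul_assoc, ← Complex.ofReal_mul, Real.mul_self_sqrt (Nat.cast_nonneg _)]
      simp
    rw [h3]
    simp [coeff, inner_smul_left]
    ring
  have h5 := hasSum_apply g z
  rw [← RKHS.kerFun_apply, hgw]
  refine h5.unique ?_
  have h6 := hs.smul_const e
  refine h6.congr_fun fun k => ?_
  rw [hg, hz, smul_smul]
  congr 1
  ring

/-! ### The module structure over `ℂ[z₁, …, zₘ]` -/

theorem exists_shift (i : Fin m) (f : DruryArveson m E) :
    ∃ g : DruryArveson m E, ∀ z : UnitBall m, g z = z.1 i • f z := by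
  classical
  let s : (Fin m → ℕ) → (Fin m → ℕ) := fun k => k + Pi.single i 1
  have hs : Function.Injective s := add_left_injective _
  let a : (Fin m → ℕ) → E := Function.extend s f.coeff 0
  have ha : ∀ k, a (s k) = f.coeff k := fun k => hs.extend_apply _ _ _
  have ha' : ∀ k, k ∉ Set.range s → a k = 0 := fun k hk =>
    Function.extend_apply' _ _ _ (by simpa using hk)
  obtain ⟨g, hg⟩ := exists_of_summable a (by
    refine (hs.summable_iff fun k hk => by simp [ha' k hk]).1 ?_
    refine f.hasSum_norm_sq.summable.of_nonneg_of_le (fun k => by simp only [Function.comp]; positivity) fun k => ?_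
    simp only [Function.comp, ha]
    have h1 : (0 : ℝ) < multinom k := Nat.cast_pos.2 (multinom_pos k)
    have h2 : (multinom k : ℝ) ≤ multinom (s k) := Nat.cast_le.2 (multinom_le_add_single k i)
    exact div_le_div_of_nonneg_left (by positivity) h1 h2)
  refine ⟨g, fun z => (hasSum_apply g z).unique ?_⟩
  refine (hs.hasSum_iff fun k hk => by simp [hg, ha' k hk]).1 ?_
  refine ((hasSum_apply f z).const_smul (z.1 i)).congr_fun fun k => ?_
  simp only [Function.comp, hg, ha, smul_smul]
  congr 1
  have : ∏ j, z.1 j ^ (Pi.single i 1 : Fin m → ℕ) j = z.1 i := by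
    simp [Pi.single_apply]
  simp only [zpw, s, Pi.add_apply, pow_add, Finset.prod_mul_distrib]
  rw [this, mul_comm]

theorem exists_polynomial_mul (p : MvPolynomial (Fin m) ℂ) (f : DruryArveson m E) :
    ∃ g : DruryArveson m E, ∀ z : UnitBall m, g z = MvPolynomial.eval z.1 p • f z := by
  induction p using MvPolynomial.induction_on with
  | C c => exact ⟨c • f, fun z => by simp⟩
  | add p q hp hq =>
    obtain ⟨g, hg⟩ := hp
    obtain ⟨h, hh⟩ := hq
    exact ⟨g + h, fun z => by simp [hg, hh, add_smul]⟩
  | mul_X p i hp =>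
    obtain ⟨g, hg⟩ := hp
    obtain ⟨h, hh⟩ := exists_shift i g
    exact ⟨h, fun z => by simp [hg, hh, smul_smul, mul_comm]⟩

/-- A polynomial `p` acts on `H²ₘ(E)` by `(p • f)(z) = p(z) f(z)`. -/
instance : SMul (MvPolynomial (Fin m) ℂ) (DruryArveson m E) where
  smul p f := (exists_polynomial_mul p f).choose

theorem polynomial_smul_apply (p : MvPolynomial (Fin m) ℂ) (f : DruryArveson m E)
    (z : UnitBall m) : (p • f) z = MvPolynomial.eval z.1 p • f z :=
  (exists_polynomial_mul p f).choose_spec z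

/-- `H²ₘ(E)` as a module over `ℂ[z₁, …, zₘ]`. -/
instance : Module (MvPolynomial (Fin m) ℂ) (DruryArveson m E) where
  one_smul f := RKHS.ext fun z => by simp [polynomial_smul_apply]
  mul_smul p q f := RKHS.ext fun z => by simp [polynomial_smul_apply, mul_smul]
  smul_zero p := RKHS.ext fun z => by simp [polynomial_smul_apply]
  smul_add p f g := RKHS.ext fun z => by simp [polynomial_smul_apply]
  add_smul p q f := RKHS.ext fun z => by simp [polynomial_smul_apply, add_smul]
  zero_smul f := RKHS.ext fun z => by simp [polynomial_smul_apply]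

instance : IsScalarTower ℂ (MvPolynomial (Fin m) ℂ) (DruryArveson m E) where
  smul_assoc c p f := RKHS.ext fun z => by simp [polynomial_smul_apply, mul_smul]

/-- A linear map given by pointwise multiplication by operators is bounded (closed graph). -/
theorem continuous_of_pointwise {F : Type*} [NormedAddCommGroup F] [InnerProductSpace ℂ F]
    [CompleteSpace F] (T : DruryArveson m E →ₗ[ℂ] DruryArveson m F) (φ : UnitBall m → E →L[ℂ] F)
    (hT : ∀ f z, (T f) z = φ z (f z)) : Continuous T := by
  refine T.continuous_of_seq_closed_graph fun u x y hu hTu => RKHS.ext fun z => ?_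
  have h1 := ((RKHS.continuous_eval (H := DruryArveson m F) z).tendsto y).comp hTu
  have h2 := (φ z).continuous.tendsto _ |>.comp
    (((RKHS.continuous_eval (H := DruryArveson m E) z).tendsto x).comp hu)
  rw [hT]
  refine tendsto_nhds_unique h1 (h2.congr fun n => ?_)
  simp [hT]

instance : ContinuousConstSMul (MvPolynomial (Fin m) ℂ) (DruryArveson m E) where
  continuous_const_smul p :=
    continuous_of_pointwise
      (T := { toFun := fun f => p • f
              map_add' := smul_add p
              map_smul' := fun c f => RKHS.ext fun z => by
                simp [polynomial_smul_apply, smul_comm c] })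
      (fun z => MvPolynomial.eval z.1 p • ContinuousLinearMap.id ℂ E)
      fun f z => by simp [polynomial_smul_apply]

end DruryArveson

section Multiplier

variable {E F : Type*} [NormedAddCommGroup E] [InnerProductSpace ℂ E] [CompleteSpace E]
  [NormedAddCommGroup F] [InnerProductSpace ℂ F] [CompleteSpace F]

/-- `θ ∈ 𝓜(E, F)`: `θ` is an operator-valued holomorphic function on the unit ball of `ℂᵐ` that
multiplies `H²ₘ(E)` into `H²ₘ(F)`. Values of `θ` outside the ball are irrelevant. -/
def IsMultiplier (m : ℕ) (θ : EuclideanSpace ℂ (Fin m) → E →L[ℂ] F) : Prop :=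
  DifferentiableOn ℂ θ (Metric.ball 0 1) ∧
    ∀ f : DruryArveson m E, ∃ g : DruryArveson m F, ∀ z : UnitBall m, g z = θ z.1 (f z)

variable {m : ℕ} {θ : EuclideanSpace ℂ (Fin m) → E →L[ℂ] F}

/-- The multiplication operator `M_θ f = θ f` as a map. -/
def IsMultiplier.mulFun (hθ : IsMultiplier m θ) (f : DruryArveson m E) : DruryArveson m F :=
  (hθ.2 f).choose

theorem IsMultiplier.mulFun_apply (hθ : IsMultiplier m θ) (f : DruryArveson m E)
    (z : UnitBall m) : hθ.mulFun f z = θ z.1 (f z) :=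
  (hθ.2 f).choose_spec z

/-- The bounded module map `M_θ : H²ₘ(E) → H²ₘ(F)`, `(M_θ f)(z) = θ(z) f(z)`. -/
def IsMultiplier.mulOp (hθ : IsMultiplier m θ) :
    DruryArveson m E →L[MvPolynomial (Fin m) ℂ] DruryArveson m F where
  toFun := hθ.mulFun
  map_add' f g := RKHS.ext fun z => by simp [hθ.mulFun_apply]
  map_smul' p f := RKHS.ext fun z => by
    simp [hθ.mulFun_apply, DruryArveson.polynomial_smul_apply]
  cont := DruryArveson.continuous_of_pointwise
    (T := { toFun := hθ.mulFun
            map_add' := fun f g => RKHS.ext fun z => by simp [hθ.mulFun_apply]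
            map_smul' := fun c f => RKHS.ext fun z => by simp [hθ.mulFun_apply] })
    (fun z => θ z.1) hθ.mulFun_apply

theorem IsMultiplier.mulOp_apply (hθ : IsMultiplier m θ) (f : DruryArveson m E)
    (z : UnitBall m) : hθ.mulOp f z = θ z.1 (f z) :=
  hθ.mulFun_apply f z

/-- The quotient module `H_θ = H²ₘ(F) / clos (ran M_θ)` over `ℂ[z₁, …, zₘ]`, with the quotient
norm. -/
abbrev IsMultiplier.quotientModule (hθ : IsMultiplier m θ) : Type _ :=
  DruryArveson m F ⧸ (LinearMap.range hθ.mulOp.toLinearMap).topologicalClosure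

end Multiplier

/-- `S` is a complemented submodule of `M`: `S` is a closed submodule and `M` is the (skew) direct
sum of `S` and another closed submodule. -/
def IsComplementedSubmodule {R M : Type*} [Ring R] [AddCommGroup M] [Module R M]
    [TopologicalSpace M] (S : Submodule R M) : Prop :=
  IsClosed (S : Set M) ∧ ∃ T : Submodule R M, IsClosed (T : Set M) ∧ IsCompl S T

/-- Two modules over `ℂ[z₁, …, zₘ]` are similar if there is a bounded module map between them with
bounded inverse. (Module maps are automatically `ℂ`-linear, as constants act as scalars.) -/
def AreSimilar (m : ℕ) (M N : Type*) [AddCommGroup M] [Module (MvPolynomial (Fin m) ℂ) M]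
    [TopologicalSpace M] [AddCommGroup N] [Module (MvPolynomial (Fin m) ℂ) N]
    [TopologicalSpace N] : Prop :=
  Nonempty (M ≃L[MvPolynomial (Fin m) ℂ] N)

end

/-!
Write `H²` for the Drury-Arveson space and `Bᵢ` for the backward shifts `M_{zᵢ}^*`. A left inverse
`ψ` of `θ` is the same as a bounded module map `Ψ` with `Ψ M_θ = 1`, because bounded module maps
between Drury-Arveson spaces are multiplications by multipliers (`exists_isMultiplier`).

Given `Ψ`, the range of `M_θ` is closed, `M_θ` is injective, and `ker Ψ` is a closed complement of
the range; hence `ker Ψ` is complemented and similar to the quotient (`similar_of_leftInverse`).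

Conversely, let `S` be complemented and similar to the quotient. The bounded projection onto `S`,
followed by the inverse similarity, is a module map from `H²` to the quotient. It lifts to a module
map `Y` from `H²` to itself by commutant lifting (`exists_lift`). On `S` the lift splits the
quotient map, so the range of `M_θ` is the range of a bounded idempotent module map, and composing it with
the inverse of `M_θ` on its range gives `Ψ` (`exists_leftInverse_of_similar`).

Commutant lifting is proved by the lurking isometry method (`exists_commuting_extension`). It rests
on the identity `‖f‖² = ‖f(0)‖² + ∑ᵢ ‖Bᵢ f‖²` (`norm_sq_eq_evalZero_add`) and on the fact that the
`n`-fold iteration of `f ↦ (Bᵢ f)ᵢ` tends strongly to `0` (`tendsto_tail`). Both follow from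
Pascal's rule for multinomial coefficients, in the form `degreeSum_succ`.
-/

/-! ### Sums over words -/

noncomputable section

section multinomial

variable {m : ℕ}

theorem sum_add_single (k : Fin m → ℕ) (i : Fin m) :
    ∑ j, (k + Pi.single i 1 : Fin m → ℕ) j = ∑ j, k j + 1 := by
  simp [Finset.sum_add_distrib]

theorem add_one_mul_multinom_add_single (k : Fin m → ℕ) (i : Fin m) :
    (k i + 1) * multinom (k + Pi.single i 1) = (∑ j, k j + 1) * multinom k := by
  have h1 := Nat.multinomial_spec Finset.univ k
  have h2 := Nat.multinomial_spec Finset.univ (k + Pi.single i 1)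
  have hs := sum_add_single k i
  have hp : ∏ j, ((k + Pi.single i 1 : Fin m → ℕ) j).factorial
      = (k i + 1) * ∏ j, (k j).factorial := by
    rw [← Finset.mul_prod_erase _ _ (Finset.mem_univ i),
      ← Finset.mul_prod_erase _ (fun j => (k j).factorial) (Finset.mem_univ i)]
    rw [Finset.prod_congr rfl (g := fun j => (k j).factorial)]
    · simp [Nat.factorial_succ, mul_assoc]
    · intro j hj
      simp [Finset.ne_of_mem_erase hj]
  rw [hs, hp, Nat.factorial_succ, ← h1] at h2
  have hP : 0 < ∏ j, (k j).factorial := Finset.prod_pos fun j _ => Nat.factorial_pos _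
  apply Nat.eq_of_mul_eq_mul_left hP
  unfold multinom
  linarith

theorem sub_single_add_single {k : Fin m → ℕ} {i : Fin m} (h : k i ≠ 0) :
    k - Pi.single i 1 + Pi.single i 1 = k := by
  ext j
  by_cases hj : j = i
  · subst hj
    simp only [Pi.add_apply, Pi.sub_apply, Pi.single_eq_same]
    omega
  · simp [hj]

/-- Pascal's rule for multinomial coefficients. -/
theorem multinom_eq_sum_sub_single {k : Fin m → ℕ} {n : ℕ} (hk : ∑ i, k i = n + 1) :
    multinom k = ∑ i, if k i ≠ 0 then multinom (k - Pi.single i 1) else 0 := by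
  apply Nat.eq_of_mul_eq_mul_left n.succ_pos
  rw [Nat.succ_eq_add_one, Finset.mul_sum]
  conv_lhs => rw [← hk, Finset.sum_mul]
  refine Finset.sum_congr rfl fun i _ => ?_
  split_ifs with h
  · have h1 := add_one_mul_multinom_add_single (k - Pi.single i 1) i
    have h2 := sum_add_single (k - Pi.single i 1) i
    have h3 : (k - Pi.single i 1 : Fin m → ℕ) i + 1 = k i := by
      simp only [Pi.sub_apply, Pi.single_eq_same]
      omega
    rw [← h2, sub_single_add_single h, h3, hk] at h1
    exact h1
  · simp [not_not.1 h]

/-- The sum `∑_{|k| = n} γₖ cₖ`, where `γₖ` is the multinomial coefficient. It is the sum of `c`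
over all words of length `n` in `m` letters, the word `w` being counted with the multi-index of its
letter multiplicities. -/
def degreeSum {V : Type*} [AddCommMonoid V] (n : ℕ) (c : (Fin m → ℕ) → V) : V :=
  ∑ k ∈ Finset.piAntidiag Finset.univ n, multinom k • c k

variable {V : Type*} [AddCommMonoid V]

theorem degreeSum_zero (c : (Fin m → ℕ) → V) : degreeSum 0 c = c 0 := by
  have : Finset.piAntidiag (Finset.univ : Finset (Fin m)) 0 = {0} := by
    ext k; simp [funext_iff]
  simp [degreeSum, this, multinom, Nat.multinomial]

/-- A word of length `n + 1` is a letter followed by a word of length `n`. -/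
theorem degreeSum_succ (n : ℕ) (c : (Fin m → ℕ) → V) :
    degreeSum (n + 1) c = ∑ i, degreeSum n fun k => c (k + Pi.single i 1) := by
  unfold degreeSum
  have h1 : ∀ k ∈ Finset.piAntidiag (Finset.univ : Finset (Fin m)) (n + 1), multinom k • c k
      = ∑ i, if k i ≠ 0 then multinom (k - Pi.single i 1) • c k else 0 := fun k hk => by
    rw [multinom_eq_sum_sub_single (by simpa using hk), Finset.sum_smul]
    refine Finset.sum_congr rfl fun i _ => ?_
    split_ifs <;> simp
  rw [Finset.sum_congr rfl h1, Finset.sum_comm]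
  refine Finset.sum_congr rfl fun i _ => ?_
  rw [← Finset.sum_filter]
  refine Finset.sum_nbij' (fun k => k - Pi.single i 1) (fun k => k + Pi.single i 1) ?_ ?_ ?_ ?_ ?_
  · intro k hk
    simp only [Finset.mem_filter, Finset.mem_piAntidiag] at hk ⊢
    have h2 := sum_add_single (k - Pi.single i 1) i
    rw [sub_single_add_single hk.2, hk.1.1] at h2
    exact ⟨(Nat.succ_injective h2).symm, by simp⟩
  · intro k hk
    simp only [Finset.mem_filter, Finset.mem_piAntidiag] at hk ⊢
    simp only [Pi.add_apply, Finset.sum_add_distrib, hk.1]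
    simp
  · intro k hk
    exact sub_single_add_single (Finset.mem_filter.1 hk).2
  · intro k _
    ext j
    simp
  · intro k hk
    dsimp only
    rw [sub_single_add_single (Finset.mem_filter.1 hk).2]

end multinomial

/-! ### Backward shifts on the Drury-Arveson space -/

namespace DruryArveson

variable {m : ℕ} {E : Type*} [NormedAddCommGroup E] [InnerProductSpace ℂ E]

theorem sqrt_multinom_ne_zero (k : Fin m → ℕ) : (√(multinom k : ℝ) : ℂ) ≠ 0 := by
  exact_mod_cast (Real.sqrt_pos.2 (by exact_mod_cast multinom_pos k)).ne'

theorem ext_coeff {f g : DruryArveson m E} (h : ∀ k, f.coeff k = g.coeff k) : f = g :=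
  lp.ext (E := fun _ : Fin m → ℕ => E) (p := 2) <| funext fun k =>
    smul_right_injective E (sqrt_multinom_ne_zero k) (h k)

theorem norm_multinom_smul_sq_div (k : Fin m → ℕ) (v : E) :
    ‖multinom k • v‖ ^ 2 / multinom k = multinom k • ‖v‖ ^ 2 := by
  have : (multinom k : ℝ) ≠ 0 := Nat.cast_ne_zero.2 (multinom_pos k).ne'
  rw [← Nat.cast_smul_eq_nsmul ℂ, norm_smul, Complex.norm_natCast, nsmul_eq_mul]
  field_simp

/-- The monomial `z ↦ zᵏ v` as an element of `H²ₘ(E)`. -/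
def mono (k : Fin m → ℕ) (v : E) : DruryArveson m E :=
  ofLp (lp.single 2 k ((√(multinom k : ℝ) : ℂ)⁻¹ • v))

theorem coeff_mono_same (k : Fin m → ℕ) (v : E) : (mono k v).coeff k = v := by
  change (√(multinom k : ℝ) : ℂ) • (lp.single 2 k ((√(multinom k : ℝ) : ℂ)⁻¹ • v) :
    lp (fun _ : Fin m → ℕ => E) 2) k = v
  rw [lp.single_apply_self, smul_inv_smul₀ (sqrt_multinom_ne_zero k)]

theorem coeff_mono_ne {j k : Fin m → ℕ} (h : j ≠ k) (v : E) : (mono k v).coeff j = 0 := by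
  change (√(multinom j : ℝ) : ℂ) • (lp.single 2 k ((√(multinom k : ℝ) : ℂ)⁻¹ • v) :
    lp (fun _ : Fin m → ℕ => E) 2) j = 0
  rw [lp.single_apply_ne _ _ _ h, smul_zero]

/-- The monomial expansion of an element of `H²ₘ(E)` converges in norm. -/
theorem hasSum_mono (f : DruryArveson m E) : HasSum (fun k => mono k (f.coeff k)) f := by
  have h := lp.hasSum_single (p := 2) (by norm_num) f.toLp
  refine HasSum.congr_fun (f := fun k => ofLp (lp.single 2 k (f.toLp k))) h fun k => ?_
  rw [mono, coeff, inv_smul_smul₀ (sqrt_multinom_ne_zero k)]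

theorem norm_mono_zero (v : E) : ‖mono (m := m) 0 v‖ = ‖v‖ := by
  have h : multinom (0 : Fin m → ℕ) = 1 := by simp [multinom, Nat.multinomial]
  refine (lp.norm_single (E := fun _ : Fin m → ℕ => E) (p := 2) (by norm_num) _ _).trans ?_
  simp [h]

variable [CompleteSpace E]

theorem mono_apply (k : Fin m → ℕ) (v : E) (z : UnitBall m) : mono k v z = zpw z.1 k • v := by
  refine (hasSum_apply (mono k v) z).unique ?_
  have h := hasSum_single (f := fun j => zpw z.1 j • (mono k v).coeff j) k fun j hj => by
    rw [coeff_mono_ne hj, smul_zero]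
  rwa [coeff_mono_same] at h

variable (m E) in
/-- The embedding of `E` into `H²ₘ(E)` as constant functions. -/
def const : E →L[ℂ] DruryArveson m E :=
  LinearMap.mkContinuous
    { toFun := mono 0
      map_add' := fun v w => RKHS.ext fun z => by simp [mono_apply]
      map_smul' := fun c v => RKHS.ext fun z => by simp [mono_apply, smul_comm c] }
    1 fun v => by simp [norm_mono_zero]

theorem const_apply (v : E) (z : UnitBall m) : const m E v z = v := by
  refine (mono_apply 0 v z).trans ?_
  simp [zpw]

variable (E) in
/-- Multiplication by a polynomial as a bounded operator. -/
def mulPoly (p : MvPolynomial (Fin m) ℂ) : DruryArveson m E →L[ℂ] DruryArveson m E where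
  toFun f := p • f
  map_add' := smul_add p
  map_smul' c f := RKHS.ext fun z => by simp [polynomial_smul_apply, smul_comm c]
  cont := continuous_const_smul p

theorem mulPoly_apply (p : MvPolynomial (Fin m) ℂ) (f : DruryArveson m E) :
    mulPoly E p f = p • f := rfl

/-- The monomial `zᵏ` as a polynomial. -/
def zmon (k : Fin m → ℕ) : MvPolynomial (Fin m) ℂ :=
  MvPolynomial.monomial (Finsupp.equivFunOnFinite.symm k) 1

theorem eval_zmon (x : Fin m → ℂ) (k : Fin m → ℕ) : MvPolynomial.eval x (zmon k) = zpw x k := by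
  simp [zmon, zpw, MvPolynomial.eval_monomial, Finsupp.prod_fintype]

theorem zmon_add (j k : Fin m → ℕ) : zmon (j + k) = zmon j * zmon k := by
  rw [zmon, zmon, zmon, MvPolynomial.monomial_mul, one_mul]
  congr 2
  ext i
  simp

theorem zmon_zero : zmon (0 : Fin m → ℕ) = 1 := by
  have : Finsupp.equivFunOnFinite.symm (0 : Fin m → ℕ) = 0 := by ext; simp
  simp [zmon, this]

theorem zmon_single (i : Fin m) : zmon (Pi.single i 1) = MvPolynomial.X i := by
  have : Finsupp.equivFunOnFinite.symm (Pi.single i 1 : Fin m → ℕ) = Finsupp.single i 1 := by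
    simp
  simp [zmon, this, MvPolynomial.X]

theorem zmon_smul_const (k : Fin m → ℕ) (v : E) : zmon k • const m E v = mono k v :=
  RKHS.ext fun z => by simp [polynomial_smul_apply, const_apply, mono_apply, eval_zmon]

variable (E) in
/-- The backward shift `B_p`: the adjoint of the multiplication by the polynomial `p`. -/
def bshift (p : MvPolynomial (Fin m) ℂ) : DruryArveson m E →L[ℂ] DruryArveson m E :=
  (mulPoly E p).adjoint

theorem bshift_mul (p q : MvPolynomial (Fin m) ℂ) (f : DruryArveson m E) :
    bshift E (p * q) f = bshift E p (bshift E q f) := by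
  refine ext_inner_left ℂ fun g => ?_
  simp only [bshift, ContinuousLinearMap.adjoint_inner_right, mulPoly_apply]
  rw [mul_comm, mul_smul]

theorem bshift_one (f : DruryArveson m E) : bshift E 1 f = f := by
  refine ext_inner_left ℂ fun g => ?_
  simp only [bshift, ContinuousLinearMap.adjoint_inner_right, mulPoly_apply, one_smul]

variable (m E) in
/-- The value at the origin, as the adjoint of the embedding of the constants. -/
def evalZero : DruryArveson m E →L[ℂ] E := (const m E).adjoint

/-- The coefficient of `zᵏ` is `γₖ` times the value at the origin of the backward shift by `zᵏ`. -/
theorem coeff_eq (f : DruryArveson m E) (k : Fin m → ℕ) :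
    f.coeff k = multinom k • evalZero m E (bshift E (zmon k) f) := by
  refine ext_inner_left ℂ fun v => ?_
  rw [← Nat.cast_smul_eq_nsmul ℂ, inner_smul_right, evalZero,
    ContinuousLinearMap.adjoint_inner_right, bshift, ContinuousLinearMap.adjoint_inner_right,
    mulPoly_apply, zmon_smul_const]
  have h1 : inner ℂ (mono k v) f =
      inner ℂ ((√(multinom k : ℝ) : ℂ)⁻¹ • v) (f.toLp k) :=
    lp.inner_single_left (𝕜 := ℂ) (G := fun _ : Fin m → ℕ => E) k
      ((√(multinom k : ℝ) : ℂ)⁻¹ • v) f.toLp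
  have h2 : (√(multinom k : ℝ) : ℂ) * (√(multinom k : ℝ) : ℂ) = multinom k := by
    rw [← Complex.ofReal_mul, Real.mul_self_sqrt (Nat.cast_nonneg _), Complex.ofReal_natCast]
  have h3 := sqrt_multinom_ne_zero k
  rw [h1, inner_smul_left, map_inv₀, Complex.conj_ofReal, coeff, inner_smul_right, ← h2]
  field_simp

/-- An element of `H²ₘ(E)` is determined by the values at the origin of its backward shifts. -/
theorem ext_evalZero {f g : DruryArveson m E}
    (h : ∀ k, evalZero m E (bshift E (zmon k) f) = evalZero m E (bshift E (zmon k) g)) : f = g :=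
  ext_coeff fun k => by rw [coeff_eq, coeff_eq, h]

theorem bshift_zmon_add_single (k : Fin m → ℕ) (i : Fin m) (f : DruryArveson m E) :
    bshift E (zmon (k + Pi.single i 1)) f
      = bshift E (zmon k) (bshift E (MvPolynomial.X i) f) := by
  rw [zmon_add, zmon_single, bshift_mul]

/-- `degreeSum n` of the squared Taylor data of `f`: the squared norm of its homogeneous part of
degree `n`. -/
theorem hasSum_degreeSum_norm_sq (f : DruryArveson m E) :
    HasSum (fun n => degreeSum n fun k => ‖evalZero m E (bshift E (zmon k) f)‖ ^ 2) (‖f‖ ^ 2) := by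
  refine (hasSum_by_degree f.hasSum_norm_sq).congr_fun fun n => ?_
  refine Finset.sum_congr rfl fun k _ => ?_
  rw [coeff_eq, norm_multinom_smul_sq_div]

/-- `I - ∑ᵢ M_{zᵢ} M_{zᵢ}^*` is the projection onto the constants. -/
theorem norm_sq_eq_evalZero_add (f : DruryArveson m E) :
    ‖f‖ ^ 2 = ‖evalZero m E f‖ ^ 2 + ∑ i, ‖bshift E (MvPolynomial.X i) f‖ ^ 2 := by
  have h1 := hasSum_degreeSum_norm_sq f
  rw [← hasSum_nat_add_iff' 1] at h1
  simp only [degreeSum_succ, bshift_zmon_add_single] at h1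
  have h2 := hasSum_sum (s := Finset.univ) fun (i : Fin m) _ =>
    hasSum_degreeSum_norm_sq (bshift E (MvPolynomial.X i) f)
  have h3 := h1.unique h2
  simp only [Finset.range_one, Finset.sum_singleton, degreeSum_zero, zmon_zero, bshift_one] at h3
  linarith

/-- The squared norm of the part of `f` of degree at least `n`. -/
def tail (n : ℕ) (f : DruryArveson m E) : ℝ :=
  ‖f‖ ^ 2 - ∑ j ∈ Finset.range n, degreeSum j fun k => ‖evalZero m E (bshift E (zmon k) f)‖ ^ 2

theorem tail_zero (f : DruryArveson m E) : tail 0 f = ‖f‖ ^ 2 := by simp [tail]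

theorem tail_succ (n : ℕ) (f : DruryArveson m E) :
    tail (n + 1) f = ∑ i, tail n (bshift E (MvPolynomial.X i) f) := by
  simp only [tail, Finset.sum_range_succ' _ n, degreeSum_zero, zmon_zero, bshift_one,
    degreeSum_succ, bshift_zmon_add_single, Finset.sum_sub_distrib]
  rw [norm_sq_eq_evalZero_add f, Finset.sum_comm]
  ring

theorem tendsto_tail (f : DruryArveson m E) :
    Filter.Tendsto (fun n => tail n f) Filter.atTop (nhds 0) := by
  have := (hasSum_degreeSum_norm_sq f).tendsto_sum_nat.const_sub (‖f‖ ^ 2)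
  rwa [sub_self] at this

/-- Taylor data with square summable degree sums come from an element of `H²ₘ(E)`. -/
theorem exists_of_degreeSum_le (h : (Fin m → ℕ) → E) (C : ℝ)
    (hC : ∀ n, ∑ j ∈ Finset.range n, degreeSum j (fun k => ‖h k‖ ^ 2) ≤ C) :
    ∃ g : DruryArveson m E, (∀ k, evalZero m E (bshift E (zmon k) g) = h k) ∧ ‖g‖ ^ 2 ≤ C := by
  have h0 : ∀ j, 0 ≤ degreeSum j (fun k => ‖h k‖ ^ 2) := fun j =>
    Finset.sum_nonneg fun k _ => by positivity
  have hs : Summable fun j => degreeSum j (fun k => ‖h k‖ ^ 2) :=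
    summable_of_sum_range_le h0 hC
  obtain ⟨g, hg⟩ := exists_of_summable (fun k => multinom k • h k) (by
    refine summable_by_degree (fun k => by positivity) ?_
    simp only [norm_multinom_smul_sq_div]
    exact hs)
  have hk : ∀ k, evalZero m E (bshift E (zmon k) g) = h k := fun k => by
    have h1 := hg k
    rw [coeff_eq, ← Nat.cast_smul_eq_nsmul ℂ, ← Nat.cast_smul_eq_nsmul ℂ] at h1
    exact smul_right_injective E (Nat.cast_ne_zero.2 (multinom_pos k).ne') h1
  refine ⟨g, hk, ?_⟩
  have h2 := hasSum_degreeSum_norm_sq g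
  simp only [hk] at h2
  exact le_of_tendsto' h2.tendsto_sum_nat hC

end DruryArveson

/-! ### Contractions between Hilbert spaces -/

section Contraction

variable {K W Z : Type*} [NormedAddCommGroup K] [InnerProductSpace ℂ K]
  [NormedAddCommGroup W] [InnerProductSpace ℂ W] [CompleteSpace W]
  [NormedAddCommGroup Z] [InnerProductSpace ℂ Z] [CompleteSpace Z]

/-- Douglas' factorisation lemma, in the form used to extend an isometry defined on the range of
`p` to a contraction of the whole space: it is `0` on the orthogonal complement of the range. -/
theorem exists_contraction_comp_eq (p : K →ₗ[ℂ] W) (q : K →ₗ[ℂ] Z) (h : ∀ k, ‖q k‖ ≤ ‖p k‖) :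
    ∃ V : W →L[ℂ] Z, (∀ k, V (p k) = q k) ∧ ∀ w, ‖V w‖ ≤ ‖w‖ := by
  let R := (LinearMap.range p).topologicalClosure
  have hR : ∀ k, p k ∈ R := fun k => Submodule.le_topologicalClosure _ ⟨k, rfl⟩
  have : CompleteSpace R := (Submodule.isClosed_topologicalClosure _).completeSpace_coe
  let e : K →ₗ[ℂ] R := p.codRestrict R hR
  have he : DenseRange e := by
    intro x
    rw [Metric.mem_closure_iff]
    intro ε hε
    obtain ⟨_, ⟨k, rfl⟩, hk⟩ := Metric.mem_closure_iff.1 x.2 ε hε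
    exact ⟨e k, ⟨k, rfl⟩, hk⟩
  have hn : ∀ k, ‖q k‖ ≤ 1 * ‖e k‖ := fun k => by simpa [e] using h k
  refine ⟨(q.extendOfNorm e).comp R.orthogonalProjectionOnto, fun k => ?_, fun w => ?_⟩
  · have h1 : R.orthogonalProjectionOnto (p k) = e k :=
      Submodule.orthogonalProjectionOnto_mem_subspace_eq_self (e k)
    rw [ContinuousLinearMap.comp_apply, h1, LinearMap.extendOfNorm_eq he ⟨1, hn⟩]
  · have h1 := LinearMap.norm_extendOfNorm_apply_le he 1 hn (R.orthogonalProjectionOnto w)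
    rw [one_mul] at h1
    exact h1.trans (R.norm_orthogonalProjectionOnto_apply_le w)

/-- The defect operator `(1 - C^* C)^{1/2}` of a contraction `C`. -/
theorem exists_defect [CompleteSpace K] (C : K →L[ℂ] Z) (hC : ∀ x, ‖C x‖ ≤ ‖x‖) :
    ∃ D : K →L[ℂ] K, ∀ x, ‖D x‖ ^ 2 = ‖x‖ ^ 2 - ‖C x‖ ^ 2 := by
  let A : K →L[ℂ] K := 1 - C.adjoint.comp C
  have hA : ∀ x, inner ℂ (A x) x = ((‖x‖ ^ 2 - ‖C x‖ ^ 2 : ℝ) : ℂ) := fun x => by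
    simp [A, ContinuousLinearMap.adjoint_inner_left, inner_self_eq_norm_sq_to_K]
  have hpos : 0 ≤ A := by
    rw [ContinuousLinearMap.nonneg_iff_isPositive, ContinuousLinearMap.isPositive_iff_complex]
    intro x
    rw [hA]
    have := pow_le_pow_left₀ (norm_nonneg _) (hC x) 2
    exact ⟨rfl, sub_nonneg.2 this⟩
  refine ⟨CFC.sqrt A, fun x => ?_⟩
  have hs : IsSelfAdjoint (CFC.sqrt A) := (CFC.sqrt_nonneg A).isSelfAdjoint
  have h1 : inner ℂ (CFC.sqrt A x) (CFC.sqrt A x) = inner ℂ (A x) x := by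
    conv_rhs => rw [← CFC.sqrt_mul_sqrt_self A hpos]
    rw [mul_apply_eq_comp]
    conv_rhs => rw [← hs.adjoint_eq]
    rw [ContinuousLinearMap.adjoint_inner_left, hs.adjoint_eq]
  rw [hA] at h1
  exact (inner_self_eq_norm_sq (𝕜 := ℂ) _).symm.trans
    ((congrArg Complex.re h1).trans (Complex.ofReal_re _))

end Contraction

/-! ### The lurking isometry and its transfer function -/

namespace DruryArveson

variable {m : ℕ} {F G K : Type*} [NormedAddCommGroup F] [InnerProductSpace ℂ F] [CompleteSpace F]
  [NormedAddCommGroup G] [InnerProductSpace ℂ G] [CompleteSpace G]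
  [NormedAddCommGroup K] [InnerProductSpace ℂ K] [CompleteSpace K]

/-- The contractive colligation of the lurking isometry argument: the hypothesis says that
`(c x, (D Tᵢ x)ᵢ) ↦ (D x, d x)` is isometric, and `(U, W)` is a contractive extension of it for the
Hilbert space norms, although it is stated on plain products. -/
theorem exists_colligation (c : K →ₗ[ℂ] F) (T : Fin m → K →ₗ[ℂ] K) (d : K →ₗ[ℂ] G)
    (D : K →ₗ[ℂ] K)
    (h : ∀ x, ‖D x‖ ^ 2 + ‖d x‖ ^ 2 = ‖c x‖ ^ 2 + ∑ i, ‖D (T i x)‖ ^ 2) :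
    ∃ (U : F × (Fin m → K) →L[ℂ] K) (W : F × (Fin m → K) →L[ℂ] G),
      (∀ x y, ‖U (x, y)‖ ^ 2 + ‖W (x, y)‖ ^ 2 ≤ ‖x‖ ^ 2 + ∑ i, ‖y i‖ ^ 2) ∧
      (∀ x, U (c x, fun i => D (T i x)) = D x) ∧ ∀ x, W (c x, fun i => D (T i x)) = d x := by
  let a : (F × (Fin m → K)) ≃L[ℂ] WithLp 2 (F × PiLp 2 fun _ : Fin m => K) :=
    ((ContinuousLinearEquiv.refl ℂ F).prodCongr
      (PiLp.continuousLinearEquiv 2 ℂ fun _ : Fin m => K).symm).trans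
    (WithLp.prodContinuousLinearEquiv 2 ℂ F (PiLp 2 fun _ : Fin m => K)).symm
  let b := WithLp.prodContinuousLinearEquiv 2 ℂ K G
  have ha : ∀ x y, ‖a (x, y)‖ ^ 2 = ‖x‖ ^ 2 + ∑ i, ‖y i‖ ^ 2 := fun x y => by
    rw [WithLp.prod_norm_sq_eq_of_L2, PiLp.norm_sq_eq_of_L2]
    rfl
  have hb : ∀ w, ‖w‖ ^ 2 = ‖(b w).1‖ ^ 2 + ‖(b w).2‖ ^ 2 := fun w =>
    WithLp.prod_norm_sq_eq_of_L2 w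
  obtain ⟨V, hV, hV'⟩ := exists_contraction_comp_eq
    (a.toLinearMap ∘ₗ c.prod (LinearMap.pi fun i => D ∘ₗ T i))
    (b.symm.toLinearMap ∘ₗ D.prod d) fun x => by
      refine le_of_sq_le_sq ?_ (norm_nonneg _)
      refine le_of_eq ?_
      refine (hb _).trans (Eq.trans ?_ (ha _ _).symm)
      simpa using h x
  refine ⟨(ContinuousLinearMap.fst ℂ K G).comp (b.toContinuousLinearMap.comp
      (V.comp a.toContinuousLinearMap)), (ContinuousLinearMap.snd ℂ K G).comp
      (b.toContinuousLinearMap.comp (V.comp a.toContinuousLinearMap)), fun x y => ?_, fun x => ?_,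
      fun x => ?_⟩
  · rw [← ha]
    refine (hb (V (a (x, y)))).symm.trans_le ?_
    exact pow_le_pow_left₀ (norm_nonneg _) (hV' _) 2
  · exact congrArg (fun w => (b w).1) (hV x)
  · exact congrArg (fun w => (b w).2) (hV x)

/-- A sequence of maps that expresses its next term at `x` contractively through the current term at
the backward shifts of `x` tends to `0` at the rate of the Taylor tails: after `n` steps it only
sees the part of degree at least `n`. -/
theorem sq_norm_le_tail {L V : Type*} [NormedAddCommGroup V] (J : L → DruryArveson m F)
    (T : Fin m → L → L) (hJ : ∀ i x, bshift F (MvPolynomial.X i) (J x) = J (T i x))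
    (Z : ℕ → L → V) (h0 : ∀ x, ‖Z 0 x‖ ≤ ‖J x‖)
    (hZ : ∀ n x, ‖Z (n + 1) x‖ ^ 2 ≤ ∑ i, ‖Z n (T i x)‖ ^ 2) (n : ℕ) (x : L) :
    ‖Z n x‖ ^ 2 ≤ tail n (J x) := by
  induction n generalizing x with
  | zero =>
    rw [tail_zero]
    exact pow_le_pow_left₀ (norm_nonneg _) (h0 x) 2
  | succ n ih =>
    rw [tail_succ]
    refine (hZ n x).trans (Finset.sum_le_sum fun i _ => ?_)
    rw [hJ]
    exact ih _

/-- The state operator `X` of a colligation: the solution of `X f = U (f(0), (X Bᵢ f)ᵢ)`, with `Bᵢ`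
the backward shifts. It is the limit of the iteration started at `0`. The last clause is the
uniqueness of the solution, on any set `L` that is mapped to `H²ₘ(F)` compatibly with the `Bᵢ`. -/
theorem exists_state (U : F × (Fin m → K) →L[ℂ] K)
    (hU : ∀ x y, ‖U (x, y)‖ ^ 2 ≤ ‖x‖ ^ 2 + ∑ i, ‖y i‖ ^ 2) :
    ∃ X : DruryArveson m F →ₗ[ℂ] K, (∀ f, ‖X f‖ ≤ ‖f‖) ∧
      (∀ f, X f = U (evalZero m F f, fun i => X (bshift F (MvPolynomial.X i) f))) ∧
      ∀ {L : Type _} (J : L → DruryArveson m F) (T : Fin m → L → L) (D : L → K),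
        (∀ i x, bshift F (MvPolynomial.X i) (J x) = J (T i x)) → (∀ x, ‖D x‖ ≤ ‖J x‖) →
        (∀ x, D x = U (evalZero m F (J x), fun i => D (T i x))) → ∀ x, X (J x) = D x := by
  let N : (DruryArveson m F →ₗ[ℂ] K) → DruryArveson m F →ₗ[ℂ] K := fun X =>
    U.toLinearMap ∘ₗ (evalZero m F).toLinearMap.prod
      (LinearMap.pi fun i => X ∘ₗ (bshift F (MvPolynomial.X i)).toLinearMap)
  have hN : ∀ X f, N X f = U (evalZero m F f, fun i => X (bshift F (MvPolynomial.X i) f)) :=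
    fun X f => rfl
  let X : ℕ → DruryArveson m F →ₗ[ℂ] K := fun n => N^[n] 0
  have hX : ∀ n, X (n + 1) = N (X n) := fun n => Function.iterate_succ_apply' _ _ _
  have hsub : ∀ x y y', ‖U (x, y) - U (x, y')‖ ^ 2 ≤ ∑ i, ‖y i - y' i‖ ^ 2 := fun x y y' => by
    rw [← map_sub]
    simpa using hU 0 (y - y')
  have hle : ∀ n f, ‖X n f‖ ≤ ‖f‖ := by
    intro n
    induction n with
    | zero => intro f; simp [X]
    | succ n ih =>
      intro f
      refine le_of_sq_le_sq ?_ (norm_nonneg _)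
      rw [hX, hN, norm_sq_eq_evalZero_add f]
      refine (hU _ _).trans ?_
      gcongr
      exact ih _
  have hcs : ∀ f, CauchySeq fun n => X n f := fun f => by
    refine cauchySeq_of_le_tendsto_0' (fun n => √(tail n f)) (fun n l hnl => ?_) ?_
    · obtain ⟨p, rfl⟩ := Nat.exists_eq_add_of_le hnl
      rw [dist_comm, dist_eq_norm]
      refine Real.le_sqrt_of_sq_le ?_
      refine sq_norm_le_tail (fun f => f) (fun i => bshift F (MvPolynomial.X i)) (fun _ _ => rfl)
        (fun n f => X (n + p) f - X n f) (fun f => ?_) (fun n f => ?_) n f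
      · simpa [X] using hle p f
      · rw [show n + 1 + p = n + p + 1 by omega, hX, hX, hN, hN]
        exact hsub _ _ _
    · simpa using (tendsto_tail f).sqrt
  choose X' hX' using fun f => cauchySeq_tendsto_of_complete (hcs f)
  refine ⟨linearMapOfTendsto X' X (tendsto_pi_nhds.2 hX'), fun f => ?_, fun f => ?_, ?_⟩
  · exact le_of_tendsto' (hX' f).norm fun n => hle n f
  · refine tendsto_nhds_unique ((Filter.tendsto_add_atTop_iff_nat 1).2 (hX' f)) ?_
    simp only [hX, hN]
    refine (U.continuous.tendsto _).comp (tendsto_const_nhds.prodMk_nhds ?_)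
    exact tendsto_pi_nhds.2 fun i => hX' _
  · intro L J T D hJ hD hDU x
    refine tendsto_nhds_unique (hX' (J x)) ?_
    rw [tendsto_iff_norm_sub_tendsto_zero]
    refine squeeze_zero (fun _ => norm_nonneg _) (fun n => Real.le_sqrt_of_sq_le ?_)
      (g := fun n => √(tail n (J x))) (by simpa using (tendsto_tail (J x)).sqrt)
    refine sq_norm_le_tail J T hJ (fun n x => X n (J x) - D x) (fun x => ?_) (fun n x => ?_) n x
    · simpa [X] using hD x
    · rw [hX, hN, hDU x]
      simp only [hJ]
      exact hsub _ _ _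

/-- Commutant lifting in its dual form: a contraction `C`, defined on a subspace `K` invariant under
the backward shifts (embedded by `J`) and commuting with them, extends to an operator on the whole
space that commutes with them.

With `D = (1 - C^* C)^{1/2}`, subtracting the identities `‖f‖² = ‖f(0)‖² + ∑ᵢ ‖Bᵢ f‖²` for `J x` and
`C x` shows that `((J x)(0), (D Tᵢ x)ᵢ) ↦ (D x, (C x)(0))` is isometric. The extension `Y` is the
transfer function of the resulting colligation, and `(Y f)(0) = W (f(0), (X Bᵢ f)ᵢ)`. -/
theorem exists_commuting_extension (T : MvPolynomial (Fin m) ℂ → K →ₗ[ℂ] K)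
    (J : K →ₗᵢ[ℂ] DruryArveson m F) (hJ : ∀ p x, bshift F p (J x) = J (T p x))
    (C : K →L[ℂ] DruryArveson m G) (hC : ∀ p x, bshift G p (C x) = C (T p x))
    (hC1 : ∀ x, ‖C x‖ ≤ ‖x‖) :
    ∃ Y : DruryArveson m F →L[ℂ] DruryArveson m G,
      (∀ i f, bshift G (MvPolynomial.X i) (Y f) = Y (bshift F (MvPolynomial.X i) f)) ∧
      ∀ x, Y (J x) = C x := by
  obtain ⟨D, hD⟩ := exists_defect C hC1
  obtain ⟨U, W, hUW, hU, hW⟩ := exists_colligation ((evalZero m F).toLinearMap ∘ₗ J.toLinearMap)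
    (fun i => T (MvPolynomial.X i)) ((evalZero m G).toLinearMap ∘ₗ C.toLinearMap) D.toLinearMap
    fun x => by
      have h1 := norm_sq_eq_evalZero_add (J x)
      have h2 := norm_sq_eq_evalZero_add (C x)
      simp only [hJ, hC, LinearIsometry.norm_map] at h1 h2
      simp [hD, Finset.sum_sub_distrib]
      linarith
  obtain ⟨X, hX1, hX, hXJ⟩ := exists_state U fun x y =>
    (le_add_of_nonneg_right (sq_nonneg _)).trans (hUW x y)
  have hXD : ∀ x, X (J x) = D x := by
    refine hXJ J (fun i => T (MvPolynomial.X i)) D (fun i x => hJ _ x) (fun x => ?_)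
      fun x => (hU x).symm
    rw [J.norm_map]
    refine le_of_sq_le_sq ?_ (norm_nonneg _)
    rw [hD]
    exact sub_le_self _ (sq_nonneg _)
  let Y₀ : DruryArveson m F →ₗ[ℂ] G := W.toLinearMap ∘ₗ (evalZero m F).toLinearMap.prod
      (LinearMap.pi fun i => X ∘ₗ (bshift F (MvPolynomial.X i)).toLinearMap)
  have hY₀ : ∀ f, Y₀ f = W (evalZero m F f, fun i => X (bshift F (MvPolynomial.X i) f)) :=
    fun f => rfl
  -- the energy balance of the colligation, summed over the first `n` degrees
  have hbal : ∀ n f, ∑ j ∈ Finset.range n, degreeSum j (fun k => ‖Y₀ (bshift F (zmon k) f)‖ ^ 2)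
      + ‖X f‖ ^ 2 ≤ ‖f‖ ^ 2 := by
    intro n
    induction n with
    | zero =>
      intro f
      simpa using pow_le_pow_left₀ (norm_nonneg _) (hX1 f) 2
    | succ n ih =>
      intro f
      simp only [Finset.sum_range_succ' _ n, degreeSum_zero, zmon_zero, bshift_one,
        degreeSum_succ, bshift_zmon_add_single]
      rw [Finset.sum_comm]
      have h1 := Finset.sum_le_sum fun i (_ : i ∈ Finset.univ) =>
        ih (bshift F (MvPolynomial.X i) f)
      rw [Finset.sum_add_distrib] at h1
      have h2 := hUW (evalZero m F f) fun i => X (bshift F (MvPolynomial.X i) f)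
      rw [← hX, ← hY₀] at h2
      rw [norm_sq_eq_evalZero_add f]
      linarith
  choose Y hY hY1 using fun f => exists_of_degreeSum_le (fun k => Y₀ (bshift F (zmon k) f))
    (‖f‖ ^ 2) fun n => (le_add_of_nonneg_right (sq_nonneg _)).trans (hbal n f)
  refine ⟨LinearMap.mkContinuous
    { toFun := Y
      map_add' := fun f g => ext_evalZero fun k => by simp [hY]
      map_smul' := fun c f => ext_evalZero fun k => by simp [hY] } 1 fun f => ?_,
    fun i f => ext_evalZero fun k => ?_, fun x => ext_evalZero fun k => ?_⟩
  · rw [one_mul]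
    exact le_of_sq_le_sq (hY1 f) (norm_nonneg _)
  · rw [← bshift_zmon_add_single]
    refine (hY f _).trans (Eq.trans ?_ (hY _ _).symm)
    rw [bshift_zmon_add_single]
  · refine (hY _ _).trans ?_
    rw [hJ, hC, hY₀]
    simp only [hJ, hXD]
    exact hW _

end DruryArveson

/-! ### Module maps and multipliers -/

namespace DruryArveson

variable {m : ℕ} {E F G : Type*} [NormedAddCommGroup E] [InnerProductSpace ℂ E] [CompleteSpace E]
  [NormedAddCommGroup F] [InnerProductSpace ℂ F] [CompleteSpace F]
  [NormedAddCommGroup G] [InnerProductSpace ℂ G] [CompleteSpace G]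

theorem C_smul (c : ℂ) (f : DruryArveson m E) :
    (MvPolynomial.C c : MvPolynomial (Fin m) ℂ) • f = c • f :=
  RKHS.ext fun z => by simp [polynomial_smul_apply]

theorem zpw_add_single (z : Fin m → ℂ) (k : Fin m → ℕ) (i : Fin m) :
    zpw z (k + Pi.single i 1) = z i * zpw z k := by
  rw [← eval_zmon, zmon_add, zmon_single, map_mul, eval_zmon, MvPolynomial.eval_X, mul_comm]

theorem hasSum_degreeSum_apply (f : DruryArveson m E) (z : UnitBall m) :
    HasSum (fun n => degreeSum n fun k => zpw z.1 k • evalZero m E (bshift E (zmon k) f))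
      (f z) := by
  refine (hasSum_by_degree (hasSum_apply f z)).congr_fun fun n => ?_
  refine Finset.sum_congr rfl fun k _ => ?_
  rw [coeff_eq, smul_comm]

/-- `f(z) = f(0) + ∑ᵢ zᵢ (Bᵢ f)(z)`, where `Bᵢ` is the backward shift. -/
theorem apply_eq_evalZero_add (f : DruryArveson m E) (z : UnitBall m) :
    f z = evalZero m E f + ∑ i, z.1 i • (bshift E (MvPolynomial.X i) f) z := by
  have h1 := hasSum_degreeSum_apply f z
  rw [← hasSum_nat_add_iff' 1] at h1
  simp only [degreeSum_succ, bshift_zmon_add_single] at h1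
  have h2 := hasSum_sum (s := Finset.univ) fun (i : Fin m) _ =>
    (hasSum_degreeSum_apply (bshift E (MvPolynomial.X i) f) z).const_smul (z.1 i)
  have h3 := h1.unique (h2.congr_fun fun n => Finset.sum_congr rfl fun i _ => by
    simp only [degreeSum, Finset.smul_sum, zpw_add_single, mul_smul]
    exact Finset.sum_congr rfl fun k _ => smul_comm _ _ _)
  simp only [Finset.range_one, Finset.sum_singleton, degreeSum_zero, zmon_zero, bshift_one] at h3
  rw [← h3]
  simp [zpw]

theorem evalCLM_apply (z : UnitBall m) (f : DruryArveson m E) : evalCLM z f = f z := rfl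

variable (E) in
/-- The operator `∑ᵢ zᵢ Bᵢ`, where `Bᵢ` is the backward shift. -/
def shiftPencil (z : EuclideanSpace ℂ (Fin m)) : DruryArveson m E →L[ℂ] DruryArveson m E :=
  ∑ i, z i • bshift E (MvPolynomial.X i)

theorem norm_shiftPencil_le (z : EuclideanSpace ℂ (Fin m)) : ‖shiftPencil E z‖ ≤ ‖z‖ := by
  refine ContinuousLinearMap.opNorm_le_bound _ (norm_nonneg _) fun f => ?_
  simp only [shiftPencil, FunLike.coe_sum, Finset.sum_apply, FunLike.coe_smul, Pi.smul_apply]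
  calc ‖∑ i, z i • bshift E (MvPolynomial.X i) f‖
      ≤ ∑ i, ‖z i‖ * ‖bshift E (MvPolynomial.X i) f‖ :=
        (norm_sum_le _ _).trans_eq (by simp [norm_smul])
    _ ≤ √(∑ i, ‖z i‖ ^ 2) * √(∑ i, ‖bshift E (MvPolynomial.X i) f‖ ^ 2) :=
        Real.sum_mul_le_sqrt_mul_sqrt _ _ _
    _ ≤ ‖z‖ * ‖f‖ := by
        rw [← EuclideanSpace.norm_eq]
        gcongr
        refine Real.sqrt_le_iff.2 ⟨norm_nonneg _, ?_⟩
        rw [norm_sq_eq_evalZero_add f]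
        exact le_add_of_nonneg_left (sq_nonneg _)

variable (E) in
/-- Evaluation at the origin after `(1 - ∑ᵢ zᵢ Bᵢ)⁻¹`. For `z` in the ball this is evaluation at
`z`, in a form that shows its holomorphy in the operator norm. `Ring.inverse` is `0` at non-units,
so the values outside the ball carry no meaning. -/
def evalOp (z : EuclideanSpace ℂ (Fin m)) : DruryArveson m E →L[ℂ] E :=
  (evalZero m E).comp (Ring.inverse (1 - shiftPencil E z))

theorem isUnit_one_sub_shiftPencil {z : EuclideanSpace ℂ (Fin m)} (hz : z ∈ Metric.ball 0 1) :
    IsUnit (1 - shiftPencil E z) :=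
  isUnit_one_sub_of_norm_lt_one ((norm_shiftPencil_le z).trans_lt (mem_ball_zero_iff.1 hz))

theorem evalOp_apply (z : UnitBall m) (f : DruryArveson m E) : evalOp E z.1 f = f z := by
  have h1 : ∀ g : DruryArveson m E, evalZero m E g = ((1 - shiftPencil E z.1) g) z := fun g => by
    have h2 : (shiftPencil E z.1 g) z = ∑ i, z.1 i • (bshift E (MvPolynomial.X i) g) z := by
      simp [shiftPencil, ← evalCLM_apply]
    rw [FunLike.coe_sub, Pi.sub_apply, one_apply_eq_self, ← evalCLM_apply, map_sub,
      evalCLM_apply, evalCLM_apply, h2, apply_eq_evalZero_add g, add_sub_cancel_right]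
  have h2 := Ring.mul_inverse_cancel _ (isUnit_one_sub_shiftPencil (E := E) z.2)
  rw [evalOp, ContinuousLinearMap.comp_apply, h1, ← mul_apply_eq_comp, h2]
  rfl

theorem differentiableOn_evalOp : DifferentiableOn ℂ (evalOp (m := m) E) (Metric.ball 0 1) := by
  intro z hz
  refine DifferentiableAt.differentiableWithinAt ?_
  have h1 : Differentiable ℂ fun z : EuclideanSpace ℂ (Fin m) => 1 - shiftPencil E z := by
    unfold shiftPencil
    fun_prop
  obtain ⟨u, hu⟩ := isUnit_one_sub_shiftPencil (E := E) hz
  have h2 := differentiableAt_inverse (𝕜 := ℂ) (isUnit_one_sub_shiftPencil (E := E) hz)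
  have h3 := h2.comp z h1.differentiableAt
  exact (differentiableAt_const (evalZero m E)).clm_comp h3

/-- Every bounded module map is the multiplication by a multiplier: its symbol at `z` sends `v` to
the value at `z` of the image of the constant `v`. -/
theorem exists_isMultiplier
    (Ψ : DruryArveson m F →L[MvPolynomial (Fin m) ℂ] DruryArveson m G) :
    ∃ ψ : EuclideanSpace ℂ (Fin m) → F →L[ℂ] G, IsMultiplier m ψ ∧
      ∀ (f : DruryArveson m F) (z : UnitBall m), Ψ f z = ψ z.1 (f z) := by
  let Ψ' : DruryArveson m F →L[ℂ] DruryArveson m G := Ψ.restrictScalars ℂ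
  have hΨ : ∀ f, Ψ' f = Ψ f := fun f => rfl
  let ψ : EuclideanSpace ℂ (Fin m) → F →L[ℂ] G := fun z =>
    (evalOp G z).comp (Ψ'.comp (const m F))
  have hψ : ∀ (f : DruryArveson m F) (z : UnitBall m), Ψ f z = ψ z.1 (f z) := fun f z => by
    have h1 := (hasSum_mono f).mapL ((evalOp G z.1).comp Ψ')
    have h2 := (hasSum_apply f z).mapL (ψ z.1)
    simp only [ContinuousLinearMap.comp_apply, evalOp_apply] at h1
    rw [← hΨ]
    refine h1.unique (h2.congr_fun fun k => ?_)
    simp only [ψ, map_smul, ContinuousLinearMap.comp_apply, evalOp_apply, hΨ]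
    rw [← zmon_smul_const, map_smul, polynomial_smul_apply, eval_zmon]
  refine ⟨ψ, ⟨?_, fun f => ⟨Ψ f, hψ f⟩⟩, hψ⟩
  exact differentiableOn_evalOp.clm_comp (differentiableOn_const _)

/-- A bounded operator commuting with the coordinate multiplications is a module map. -/
theorem exists_moduleMap (Y : DruryArveson m F →L[ℂ] DruryArveson m G)
    (hY : ∀ i f, Y ((MvPolynomial.X i : MvPolynomial (Fin m) ℂ) • f) 
      = (MvPolynomial.X i : MvPolynomial (Fin m) ℂ) • Y f) :
    ∃ Z : DruryArveson m F →L[MvPolynomial (Fin m) ℂ] DruryArveson m G, ∀ f, Z f = Y f := by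
  refine ⟨{ toFun := Y, map_add' := map_add Y, map_smul' := fun p f => ?_, cont := Y.continuous },
    fun f => rfl⟩
  induction p using MvPolynomial.induction_on generalizing f with
  | C c => simp [C_smul]
  | add p q hp hq =>
    dsimp only [RingHom.id_apply] at *
    rw [add_smul, map_add, hp, hq, add_smul]
  | mul_X p i hp =>
    dsimp only [RingHom.id_apply] at *
    rw [mul_smul, hp, hY, mul_smul]

/-! ### Commutant lifting -/

/-- Commutant lifting, without control of the norm: a bounded module map into a quotient of
`H²ₘ(G)` lifts to `H²ₘ(G)`. The quotient is identified with `K = N^⊥`, which is invariant under the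
backward shifts, and the lift is the adjoint of a commuting extension of the adjoint map from `K`
to `H²ₘ(F)`. -/
theorem exists_lift (N : Submodule (MvPolynomial (Fin m) ℂ) (DruryArveson m G))
    (hN : IsClosed (N : Set (DruryArveson m G)))
    (A : DruryArveson m F →L[MvPolynomial (Fin m) ℂ] DruryArveson m G ⧸ N) :
    ∃ Y : DruryArveson m F →L[MvPolynomial (Fin m) ℂ] DruryArveson m G,
      ∀ f, N.mkQ (Y f) = A f := by
  let Nc : Submodule ℂ (DruryArveson m G) := N.restrictScalars ℂ
  have : CompleteSpace Nc := hN.completeSpace_coe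
  let K : Submodule ℂ (DruryArveson m G) := Ncᗮ
  have hmemK : ∀ x, x ∈ K ↔ ∀ y ∈ N, inner ℂ y x = 0 := fun x => Nc.mem_orthogonal x
  let P := K.orthogonalProjectionOnto
  have hP : ∀ x, P x = 0 ↔ x ∈ N := fun x => by
    rw [Submodule.orthogonalProjectionOnto_eq_zero_iff, Submodule.orthogonal_orthogonal]
    rfl
  have hPeq : ∀ x y, x - y ∈ N → P x = P y := fun x y h => by
    rw [← sub_eq_zero, ← map_sub, hP]
    exact h
  have hPP : ∀ x, x - (P x : DruryArveson m G) ∈ N := fun x => by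
    rw [← hP, map_sub, sub_eq_zero]
    exact (Submodule.orthogonalProjectionOnto_mem_subspace_eq_self (P x)).symm
  -- `P` descends to the quotient by `N`
  let ι : DruryArveson m G ⧸ N → K := fun q => P (Function.surjInv N.mkQ_surjective q)
  have hι : ∀ x, ι (N.mkQ x) = P x := fun x => by
    refine hPeq _ _ ((Submodule.Quotient.eq N).1 ?_)
    exact Function.surjInv_eq N.mkQ_surjective (N.mkQ x)
  have hιc : Continuous ι := by
    rw [N.isOpenQuotientMap_mkQ.isQuotientMap.continuous_iff]
    exact P.continuous.congr fun x => (hι x).symm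
  have hA : ∀ f, ∃ x, A f = N.mkQ x := fun f => ⟨_, (N.mkQ_surjective (A f)).choose_spec.symm⟩
  have hιp : ∀ (p : MvPolynomial (Fin m) ℂ) f,
      ι (A (p • f)) = P (p • (ι (A f) : DruryArveson m G)) := fun p f => by
    obtain ⟨x, hx⟩ := hA f
    rw [map_smul, hx, ← map_smul, hι, hι]
    refine hPeq _ _ ?_
    rw [← smul_sub]
    exact N.smul_mem p (hPP x)
  let A' : DruryArveson m F →L[ℂ] K :=
    { toFun := fun f => ι (A f)
      map_add' := fun f g => by
        obtain ⟨x, hx⟩ := hA f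
        obtain ⟨y, hy⟩ := hA g
        rw [map_add, hx, hy, ← map_add, hι, hι, hι, map_add]
      map_smul' := fun c f => by
        rw [← C_smul, hιp, C_smul, map_smul]
        congr 1
        exact Submodule.orthogonalProjectionOnto_mem_subspace_eq_self _
      cont := hιc.comp A.continuous }
  have hA' : ∀ f, A' f = ι (A f) := fun f => rfl
  let T : MvPolynomial (Fin m) ℂ → K →ₗ[ℂ] K := fun p =>
    (bshift G p).toLinearMap.restrict fun x hx => by
      rw [hmemK] at hx ⊢
      intro y hy
      refine (ContinuousLinearMap.adjoint_inner_right _ _ _).trans ?_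
      exact hx _ (N.smul_mem p hy)
  have hT : ∀ p x, (T p x : DruryArveson m G) = bshift G p x := fun p x => rfl
  have hint : ∀ p x, bshift F p (A'.adjoint x) = A'.adjoint (T p x) := fun p x => by
    refine ext_inner_right ℂ fun f => ?_
    rw [bshift, ContinuousLinearMap.adjoint_inner_left, ContinuousLinearMap.adjoint_inner_left,
      ContinuousLinearMap.adjoint_inner_left, mulPoly_apply, hA', hιp, ← hA',
      Submodule.inner_orthogonalProjectionOnto_eq_of_mem_left, Submodule.coe_inner, hT, bshift,
      ContinuousLinearMap.adjoint_inner_left, mulPoly_apply]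
  -- the adjoint is divided by `r` to become a contraction
  let r : ℝ := ‖A'‖ + 1
  have hr : 0 < r := by positivity
  have hr' : (r : ℂ) ≠ 0 := by exact_mod_cast hr.ne'
  obtain ⟨Y, hYB, hYC⟩ := exists_commuting_extension T K.subtypeₗᵢ (fun p x => rfl)
    ((r : ℂ)⁻¹ • A'.adjoint) (fun p x => by simp [hint]) fun x => by
      rw [FunLike.coe_smul, Pi.smul_apply, norm_smul, norm_inv, Complex.norm_real,
        Real.norm_of_nonneg hr.le, inv_mul_le_iff₀ hr]
      refine (A'.adjoint.le_opNorm x).trans ?_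
      rw [LinearIsometryEquiv.norm_map]
      gcongr
      exact le_add_of_nonneg_right zero_le_one
  obtain ⟨Z, hZ⟩ := exists_moduleMap ((r : ℂ) • Y.adjoint) fun i f => by
    refine ext_inner_left ℂ fun g => ?_
    have h1 := hYB i g
    have h2 : inner ℂ g ((MvPolynomial.X i : MvPolynomial (Fin m) ℂ) • (r : ℂ) • Y.adjoint f)
        = inner ℂ (bshift G (MvPolynomial.X i) g) ((r : ℂ) • Y.adjoint f) :=
      (ContinuousLinearMap.adjoint_inner_left (mulPoly G (MvPolynomial.X i)) _ _).symm
    have h3 : inner ℂ (Y g) ((MvPolynomial.X i : MvPolynomial (Fin m) ℂ) • f)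
        = inner ℂ (bshift F (MvPolynomial.X i) (Y g)) f :=
      (ContinuousLinearMap.adjoint_inner_left (mulPoly F (MvPolynomial.X i)) _ _).symm
    simp only [FunLike.coe_smul, Pi.smul_apply]
    rw [h2, inner_smul_right, inner_smul_right, ContinuousLinearMap.adjoint_inner_right,
      ContinuousLinearMap.adjoint_inner_right, h3, h1]
  refine ⟨Z, fun f => ?_⟩
  obtain ⟨x, hx⟩ := hA f
  rw [hx, ← sub_eq_zero, ← map_sub, ← LinearMap.mem_ker, Submodule.ker_mkQ, ← hP, map_sub,
    sub_eq_zero, ← hι x, ← hx, ← hA']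
  refine ext_inner_left ℂ fun k => ?_
  have h1 : Y k = (r : ℂ)⁻¹ • A'.adjoint k := hYC k
  rw [Submodule.inner_orthogonalProjectionOnto_eq_of_mem_left, hZ, FunLike.coe_smul, Pi.smul_apply,
    inner_smul_right, ContinuousLinearMap.adjoint_inner_right, h1, inner_smul_left,
    ContinuousLinearMap.adjoint_inner_left, map_inv₀, Complex.conj_ofReal, mul_inv_cancel_left₀ hr']

end DruryArveson

/-! ### Left inverses and complemented submodules -/

namespace DruryArveson

variable {m : ℕ} {E F : Type*} [NormedAddCommGroup E] [InnerProductSpace ℂ E] [CompleteSpace E]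
  [NormedAddCommGroup F] [InnerProductSpace ℂ F] [CompleteSpace F]

/-- The projection onto a closed submodule along a closed complement is bounded. -/
theorem exists_projectionOnto {S T : Submodule (MvPolynomial (Fin m) ℂ) (DruryArveson m F)}
    (hS : IsClosed (S : Set (DruryArveson m F))) (hT : IsClosed (T : Set (DruryArveson m F)))
    (h : IsCompl S T) :
    ∃ Q : DruryArveson m F →L[MvPolynomial (Fin m) ℂ] S, ∀ s : S, Q s = s := by
  refine ⟨{ toLinearMap := S.projectionOnto T h, cont := ?_ }, S.projectionOnto_apply_left h⟩
  have hc : Continuous ((S.projection T h).restrictScalars ℂ) := by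
    refine LinearMap.continuous_of_seq_closed_graph _ fun u x y hu hQ => ?_
    have hyS : y ∈ S := hS.mem_of_tendsto hQ
      (Filter.Eventually.of_forall fun n => (S.projectionOnto T h (u n)).2)
    have hyT : x - y ∈ T := hT.mem_of_tendsto (hu.sub hQ) <| Filter.Eventually.of_forall fun n => by
      change u n - S.projection T h (u n) ∈ T
      rw [← Submodule.projectionOnto_apply_eq_zero_iff h, map_sub,
        Submodule.projectionOnto_projection, sub_self]
    have h1 : S.projectionOnto T h x = S.projectionOnto T h y := by
      rw [← sub_eq_zero, ← map_sub, Submodule.projectionOnto_apply_eq_zero_iff]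
      exact hyT
    change y = (S.projectionOnto T h x : DruryArveson m F)
    rw [h1, Submodule.projectionOnto_apply_of_mem_left h hyS]
  exact hc.subtype_mk _

/-- A bounded module map with values in the range of an injective bounded module map factors
through it, with a bounded factor. -/
theorem exists_factor (M : DruryArveson m E →L[MvPolynomial (Fin m) ℂ] DruryArveson m F)
    (hM : Function.Injective M)
    (P : DruryArveson m F →L[MvPolynomial (Fin m) ℂ] DruryArveson m F)
    (hP : ∀ f, P f ∈ Set.range M) :
    ∃ Ψ : DruryArveson m F →L[MvPolynomial (Fin m) ℂ] DruryArveson m E, ∀ f, M (Ψ f) = P f := by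
  choose Ψ hΨ using hP
  let L : DruryArveson m F →ₗ[MvPolynomial (Fin m) ℂ] DruryArveson m E :=
    { toFun := Ψ
      map_add' := fun f g => hM (by simp [hΨ])
      map_smul' := fun p f => hM (by simp [hΨ]) }
  have hc : Continuous (L.restrictScalars ℂ) := by
    refine LinearMap.continuous_of_seq_closed_graph _ fun u x y hu hL => hM ?_
    refine tendsto_nhds_unique ((M.continuous.tendsto y).comp hL)
      (((P.continuous.tendsto x).comp hu).congr fun n => (hΨ _).symm) |>.trans (hΨ x).symm
  exact ⟨{ toLinearMap := L, cont := hc }, hΨ⟩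

/-- If the quotient by the range of an injective bounded module map with closed range is similar
to a complemented submodule `S`, the module map has a bounded left inverse. The projection onto `S`
followed by the inverse similarity is a module map into the quotient, and its lift gives a section
of the quotient map. -/
theorem exists_leftInverse_of_similar
    (M : DruryArveson m E →L[MvPolynomial (Fin m) ℂ] DruryArveson m F)
    (hM : Function.Injective M) (hcl : IsClosed (Set.range M))
    {S : Submodule (MvPolynomial (Fin m) ℂ) (DruryArveson m F)} (hS : IsComplementedSubmodule S)
    (e : (DruryArveson m F ⧸ (LinearMap.range M.toLinearMap).topologicalClosure)
      ≃L[MvPolynomial (Fin m) ℂ] S) :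
    ∃ Ψ : DruryArveson m F →L[MvPolynomial (Fin m) ℂ] DruryArveson m E, ∀ f, Ψ (M f) = f := by
  obtain ⟨hS, T, hT, hST⟩ := hS
  obtain ⟨Q, hQ⟩ := exists_projectionOnto hS hT hST
  let N := (LinearMap.range M.toLinearMap).topologicalClosure
  have hN : ∀ f, f ∈ N ↔ f ∈ Set.range M := fun f => by
    rw [← SetLike.mem_coe, Submodule.topologicalClosure_coe]
    change f ∈ closure (Set.range M) ↔ _
    rw [hcl.closure_eq]
  obtain ⟨Y, hY⟩ := exists_lift N (Submodule.isClosed_topologicalClosure _)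
    ((e.symm : S →L[MvPolynomial (Fin m) ℂ] _).comp Q)
  -- the lift splits the quotient map over `S`, so that `P` is a projection onto the range of `M`
  let P : DruryArveson m F →L[MvPolynomial (Fin m) ℂ] DruryArveson m F :=
    ContinuousLinearMap.id _ _ - Y.comp (S.subtypeL.comp
      ((e : _ →L[MvPolynomial (Fin m) ℂ] S).comp N.mkQL))
  have hP : ∀ f, P f = f - Y (e (N.mkQ f)) := fun f => rfl
  obtain ⟨Ψ, hΨ⟩ := exists_factor M hM P fun f => by
    rw [← hN, ← Submodule.Quotient.mk_eq_zero, ← Submodule.mkQ_apply, hP, map_sub, hY, sub_eq_zero]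
    change _ = e.symm (Q (e (N.mkQ f)))
    rw [hQ, e.symm_apply_apply]
  refine ⟨Ψ, fun f => hM ?_⟩
  have h0 : N.mkQ (M f) = 0 := by
    rw [Submodule.mkQ_apply, Submodule.Quotient.mk_eq_zero, hN]
    exact ⟨f, rfl⟩
  rw [hΨ, hP, h0, map_zero, Submodule.coe_zero, map_zero, sub_zero]

/-- A module map `M` with a left inverse `Ψ` has a closed range complemented by `ker Ψ`, which is
therefore similar to the quotient by the range. -/
theorem similar_of_leftInverse
    (M : DruryArveson m E →L[MvPolynomial (Fin m) ℂ] DruryArveson m F)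
    (Ψ : DruryArveson m F →L[MvPolynomial (Fin m) ℂ] DruryArveson m E)
    (h : ∀ f, Ψ (M f) = f) :
    IsClosed (Set.range M) ∧ LinearMap.ker M.toLinearMap = ⊥ ∧
      ∃ S : Submodule (MvPolynomial (Fin m) ℂ) (DruryArveson m F), IsComplementedSubmodule S ∧
        AreSimilar m (DruryArveson m F ⧸ (LinearMap.range M.toLinearMap).topologicalClosure) S := by
  have hfix : ∀ f, f ∈ Set.range M ↔ M (Ψ f) = f := fun f =>
    ⟨by rintro ⟨g, rfl⟩; rw [h], fun hf => ⟨_, hf⟩⟩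
  have hcl : IsClosed (Set.range M) := by
    have : Set.range M = {f | M (Ψ f) = f} := Set.ext hfix
    rw [this]
    exact isClosed_eq (M.continuous.comp Ψ.continuous) continuous_id
  let N := (LinearMap.range M.toLinearMap).topologicalClosure
  have hN : ∀ f, f ∈ N ↔ M (Ψ f) = f := fun f => by
    rw [← hfix, ← SetLike.mem_coe, Submodule.topologicalClosure_coe]
    change f ∈ closure (Set.range M) ↔ _
    rw [hcl.closure_eq]
  let S := LinearMap.ker Ψ.toLinearMap
  have hS : ∀ f, f ∈ S ↔ Ψ f = 0 := fun f => LinearMap.mem_ker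
  refine ⟨hcl, LinearMap.ker_eq_bot.2 (Function.LeftInverse.injective h), S,
    ⟨isClosed_singleton.preimage Ψ.continuous, N, Submodule.isClosed_topologicalClosure _, ?_⟩, ?_⟩
  · rw [isCompl_iff, Submodule.disjoint_def, Submodule.codisjoint_iff_exists_add_eq]
    refine ⟨fun f hf hf' => ?_, fun f => ⟨f - M (Ψ f), M (Ψ f), ?_, ?_, sub_add_cancel _ _⟩⟩
    · rw [← (hN f).1 hf', (hS f).1 hf, map_zero]
    · rw [hS, map_sub, h, sub_self]
    · rw [hN, h]
  · let R : DruryArveson m F →L[MvPolynomial (Fin m) ℂ] S :=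
      (ContinuousLinearMap.id _ _ - M.comp Ψ).codRestrict S fun f => by
        rw [hS]
        simp [h]
    have hR : ∀ f, (R f : DruryArveson m F) = f - M (Ψ f) := fun f => rfl
    have hRN : N ≤ LinearMap.ker R.toLinearMap := fun f hf => by
      refine LinearMap.mem_ker.2 (Subtype.ext ?_)
      exact sub_eq_zero.2 ((hN f).1 hf).symm
    refine ⟨{ toLinearMap := N.liftQ R.toLinearMap hRN
              invFun := fun s => N.mkQ s
              left_inv := fun q => ?_
              right_inv := fun s => Subtype.ext ?_
              continuous_toFun := ?_
              continuous_invFun := N.mkQL.continuous.comp continuous_subtype_val }⟩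
    · obtain ⟨f, rfl⟩ := N.mkQ_surjective q
      change N.mkQ (f - M (Ψ f)) = N.mkQ f
      rw [map_sub, sub_eq_self, Submodule.mkQ_apply, Submodule.Quotient.mk_eq_zero, hN, h]
    · change (s : DruryArveson m F) - M (Ψ s) = s
      rw [(hS _).1 s.2, map_zero, sub_zero]
    · exact N.isOpenQuotientMap_mkQ.isQuotientMap.continuous_iff.2 R.continuous

end DruryArveson

end

theorem mainTheorem8 {m : ℕ} {E F : Type*}
    [NormedAddCommGroup E] [InnerProductSpace ℂ E] [CompleteSpace E]
    [NormedAddCommGroup F] [InnerProductSpace ℂ F] [CompleteSpace F]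
    (θ : EuclideanSpace ℂ (Fin m) → E →L[ℂ] F) (hθ : IsMultiplier m θ) :
    (∃ ψ : EuclideanSpace ℂ (Fin m) → F →L[ℂ] E, IsMultiplier m ψ ∧
      ∀ z ∈ Metric.ball (0 : EuclideanSpace ℂ (Fin m)) 1,
        (ψ z).comp (θ z) = ContinuousLinearMap.id ℂ E) ↔
    (IsClosed (Set.range hθ.mulOp) ∧ LinearMap.ker hθ.mulOp.toLinearMap = ⊥ ∧
      ∃ S : Submodule (MvPolynomial (Fin m) ℂ) (DruryArveson m F),
        IsComplementedSubmodule S ∧ AreSimilar m hθ.quotientModule S) := by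
  constructor
  · rintro ⟨ψ, hψ, h⟩
    refine DruryArveson.similar_of_leftInverse hθ.mulOp hψ.mulOp fun f => RKHS.ext fun z => ?_
    rw [hψ.mulOp_apply, hθ.mulOp_apply, ← ContinuousLinearMap.comp_apply, h z.1 z.2]
    rfl
  · rintro ⟨hcl, hker, S, hS, ⟨e⟩⟩
    obtain ⟨Ψ, hΨ⟩ := DruryArveson.exists_leftInverse_of_similar hθ.mulOp
      (LinearMap.ker_eq_bot.1 hker) hcl hS e
    obtain ⟨ψ, hψ, h⟩ := DruryArveson.exists_isMultiplier Ψ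
    refine ⟨ψ, hψ, fun z hz => ContinuousLinearMap.ext fun v => ?_⟩
    have h1 := h (hθ.mulOp (DruryArveson.const m E v)) ⟨z, hz⟩
    rw [hΨ, hθ.mulOp_apply, DruryArveson.const_apply] at h1
    exact h1.symm
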